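/- Let $\Omega$ be the category of finite rooted trees (stumps and the tree $\eta$ with a single edge are allowed), whose morphisms $S\to T$ are the morphisms $\Omega(S)\to\Omega(T)$ of the coloured symmetric operads freely generated by $S$ and $T$. For an integer $n\ge 0$ and a tree $T$, let $\Delta[n]\otimes\Omega[T]$ be the tensor product of dendroidal sets, i.e. the dendroidal nerve of the Boardman–Vogt tensor product of the operads of $[n]$ and of $T$, where $[n]$ is regarded as the linear tree with edges $0,1,\dots,n$, root $0$ and leaf $n$; for a simplicial set $X$, the dendroidal set $X\otimes\Omega[T]$ is defined by extending this so as to preserve colimits in $X$. The edges of a tree $S$ are partially ordered with the root minimal and the leaves maximal. A height function on $S$ (with respect to $n$) assigns to each edge $e$ of $S$ a non-empty subset $h(e)\subseteq\{0,1,\dots,n\}$ such that $i\le i'$ whenever $e<e'$, $i\in h(e)$ and $i'\in h(e')$. A face of $T$ is a monomorphism $u\colon S\rightarrowtail T$ in $\Omega$. Lemma. For every $n\ge 0$ and every tree $T$ there is a bijection between isomorphism classes of monomorphisms $f\colon\Omega[S']\rightarrowtail\Delta[n]\otimes\Omega[T]$, with $S'$ a tree, and isomorphism classes of pairs $(u,h)$,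 where $u\colon S\rightarrowtail T$ is a face of $T$ and $h$ is a height function on $S$ (isomorphisms are isomorphisms of $S'$, respectively of $S$, compatible with $f$, respectively with $u$ and $h$). If the class of $f$ corresponds to that of $(u,h)$, and $f$ is given on edges by $x\mapsto(h'(x),u'(x))\in\{0,\dots,n\}\times\mathrm{Edges}(T)$, then there is a degeneracy (split epimorphism in $\Omega$) $\sigma\colon S'\twoheadrightarrow S$ such that $u'=u\circ\sigma$ on edges and $h(e)=\{h'(x) : \sigma(x)=e\}$ for every edge $e$ of $S$. Moreover, in this case: (1) For $i\in\{0,\dots,n\}$, $f$ factors through $\partial_i\Delta[n]\otimes\Omega[T]\to\Delta[n]\otimes\Omega[T]$, where $\partial_i\Delta[n]$ is the face opposite to the vertex $i$, if and only if $i\notin h(e)$ for all edges $e$ of $S$. More generally, for $I\subseteq\{0,\dots,n\}$, $f$ factors through $\bigl(\bigcap_{i\in I}\partial_i\Delta[n]\bigr)\otimes\Omega[T]\to\Delta[n]\otimes\Omega[T]$ if and only if no element of $I$ belongs to $h(e)$ for any edge $e$ of $S$. (2) For every face $v\colon F\rightarrowtail T$, $f$ factors through $\Delta[n]\otimes\Omega[F]\to\Delta[n]\otimes\Omega[T]$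 if and only if $u\colon S\rightarrowtail T$ factors through $v$. -/

import Mathlib

open CategoryTheory

universe w w₁ w₂ w₃ w₄

namespace Dendroidal

/-! ### Coloured symmetric operads -/

/-- A coloured symmetric operad (in sets). An operation has a finite type `I` of inputs, coloured
by `c : I → Color`, and an output colour; the symmetric structure is relabelling of the inputs
along bijections. (For `I = Fin n` this is the usual presentation with actions of the symmetric
groups; every finite type being in bijection with some `Fin n`, the two are equivalent.) -/
structure Operad where
  Color : Type
  Op : ∀ {I : Type} [Finite I], (I → Color) → Color → Type w
  one : ∀ c : Color, Op (fun _ : Unit => c) c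
  reindex : ∀ {I J : Type} [Finite I] [Finite J] (σ : J ≃ I) {c : I → Color} {d : Color},
    Op c d → Op (fun j => c (σ j)) d
  comp : ∀ {I : Type} [Finite I] {J : I → Type} [∀ i, Finite (J i)] {c : I → Color} {d : Color}
    {b : ∀ i, J i → Color}, Op c d → (∀ i, Op (b i) (c i)) →
      Op (fun x : Σ i, J i => b x.1 x.2) d
  reindex_refl : ∀ {I : Type} [Finite I] {c : I → Color} {d : Color} (p : Op c d),
    reindex (Equiv.refl I) p = p
  reindex_trans : ∀ {I J K : Type} [Finite I] [Finite J] [Finite K] (σ : J ≃ I) (τ : K ≃ J)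
    {c : I → Color} {d : Color} (p : Op c d),
    reindex τ (reindex σ p) = reindex (τ.trans σ) p
  one_comp : ∀ {I : Type} [Finite I] {c : I → Color} {d : Color} (p : Op c d),
    comp (one d) (fun _ => p) =
      reindex ((Equiv.sigmaEquivProd Unit I).trans (Equiv.punitProd I)) p
  comp_one : ∀ {I : Type} [Finite I] {c : I → Color} {d : Color} (p : Op c d),
    comp p (fun i => one (c i)) = reindex (Equiv.sigmaUnique I (fun _ => Unit)) p
  assoc : ∀ {I : Type} [Finite I] {J : I → Type} [∀ i, Finite (J i)]
    {K : ∀ i, J i → Type} [∀ i j, Finite (K i j)] {c : I → Color} {d : Color}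
    {b : ∀ i, J i → Color} {a : ∀ i j, K i j → Color}
    (p : Op c d) (q : ∀ i, Op (b i) (c i)) (r : ∀ i j, Op (a i j) (b i j)),
    comp (comp p q) (fun x => r x.1 x.2) =
      reindex (Equiv.sigmaAssoc K) (comp p (fun i => comp (q i) (r i)))
  comp_reindex_left : ∀ {I I' : Type} [Finite I] [Finite I'] {J : I → Type}
    [∀ i, Finite (J i)] (σ : I' ≃ I) {c : I → Color} {d : Color} {b : ∀ i, J i → Color}
    (p : Op c d) (q : ∀ i, Op (b i) (c i)),
    comp (reindex σ p) (fun i' => q (σ i')) =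
      reindex (Equiv.sigmaCongrLeft (β := J) σ) (comp p q)
  comp_reindex_right : ∀ {I : Type} [Finite I] {J J' : I → Type} [∀ i, Finite (J i)]
    [∀ i, Finite (J' i)] (τ : ∀ i, J' i ≃ J i) {c : I → Color} {d : Color}
    {b : ∀ i, J i → Color} (p : Op c d) (q : ∀ i, Op (b i) (c i)),
    comp p (fun i => reindex (τ i) (q i)) = reindex (Equiv.sigmaCongrRight τ) (comp p q)

namespace Operad

/-- Morphisms of coloured symmetric operads. -/
structure Hom (P : Operad.{w₁}) (Q : Operad.{w₂}) where
  color : P.Color → Q.Color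
  op : ∀ {I : Type} [Finite I] {c : I → P.Color} {d : P.Color},
    P.Op c d → Q.Op (fun i => color (c i)) (color d)
  op_one : ∀ c, op (P.one c) = Q.one (color c)
  op_reindex : ∀ {I J : Type} [Finite I] [Finite J] (σ : J ≃ I) {c : I → P.Color} {d : P.Color}
    (p : P.Op c d), op (P.reindex σ p) = Q.reindex σ (op p)
  op_comp : ∀ {I : Type} [Finite I] {J : I → Type} [∀ i, Finite (J i)] {c : I → P.Color}
    {d : P.Color} {b : ∀ i, J i → P.Color} (p : P.Op c d) (q : ∀ i, P.Op (b i) (c i)),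
    op (P.comp p q) = Q.comp (op p) (fun i => op (q i))

/-- The identity morphism. -/
def Hom.id (P : Operad.{w}) : Hom P P where
  color := fun c => c
  op := fun p => p
  op_one _ := rfl
  op_reindex _ _ _ _ := rfl
  op_comp _ _ := rfl

/-- Composition of morphisms, in diagrammatic order. -/
def Hom.comp {P : Operad.{w₁}} {Q : Operad.{w₂}} {R : Operad.{w₃}} (F : Hom P Q) (G : Hom Q R) :
    Hom P R where
  color := fun c => G.color (F.color c)
  op := fun p => G.op (F.op p)
  op_one c := by rw [F.op_one, G.op_one]
  op_reindex σ _ _ p := by rw [F.op_reindex, G.op_reindex]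
  op_comp p q := by rw [F.op_comp, G.op_comp]

/-- A preorder, regarded as a category and hence as an operad with unary operations only. There
is one operation with input `x` and output `y` when `y ≤ x`. Thus, for the linear order
`0 < 1 < ⋯ < n` this is the operad of the linear tree with edges `0, …, n`, root `0` and
leaf `n`. -/
def ofPreorder (X : Type) [Preorder X] : Operad.{0} where
  Color := X
  Op := fun {I} _ c d => PLift (∃ i : I, (∀ j, j = i) ∧ d ≤ c i)
  one c := ⟨⟨(), fun _ => rfl, le_refl c⟩⟩
  reindex σ c d p := ⟨by
    obtain ⟨i, hi, h⟩ := p.down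
    exact ⟨σ.symm i, fun j => by rw [← hi (σ j), σ.symm_apply_apply], by simpa using h⟩⟩
  comp {I} _ J _ c d b p q := ⟨by
    obtain ⟨i, hi, h⟩ := p.down
    obtain ⟨j, hj, h'⟩ := (q i).down
    refine ⟨⟨i, j⟩, fun x => ?_, h.trans h'⟩
    obtain ⟨i', j'⟩ := x
    obtain rfl := hi i'
    rw [hj j']⟩
  reindex_refl _ := rfl
  reindex_trans _ _ _ _ _ := rfl
  one_comp _ := rfl
  comp_one _ := rfl
  assoc _ _ _ := rfl
  comp_reindex_left := by intros; rfl
  comp_reindex_right := by intros; rfl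

/-- Monotone maps induce morphisms of operads. -/
def ofPreorderMap {X Y : Type} [Preorder X] [Preorder Y] (f : X →o Y) :
    Hom (ofPreorder X) (ofPreorder Y) where
  color := f
  op := fun p => ⟨by
    obtain ⟨i, hi, h⟩ := p.down
    exact ⟨i, hi, f.monotone h⟩⟩
  op_one _ := rfl
  op_reindex _ _ _ _ := rfl
  op_comp _ _ := rfl

/-! ### The Boardman–Vogt tensor product -/

/-- Formal composites of the generating operations `p ⊗ b` (`p` an operation of `P`, `b` a colour
of `Q`) and `a ⊗ q` (`a` a colour of `P`, `q` an operation of `Q`), with variables from `I`. -/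
inductive BVTerm (P : Operad.{w₁}) (Q : Operad.{w₂}) {I : Type} (c : I → P.Color × Q.Color) :
    P.Color × Q.Color → Type (max 1 w₁ w₂)
  | var (i : I) : BVTerm P Q c (c i)
  | left {J : Type} [Finite J] {a : J → P.Color} {a' : P.Color} (b : Q.Color) (p : P.Op a a')
      (t : ∀ j, BVTerm P Q c (a j, b)) : BVTerm P Q c (a', b)
  | right {J : Type} [Finite J] {b : J → Q.Color} {b' : Q.Color} (a : P.Color) (q : Q.Op b b')
      (t : ∀ j, BVTerm P Q c (a, b j)) : BVTerm P Q c (a, b')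

namespace BVTerm

/-- The congruence generated by: `- ⊗ b` and `a ⊗ -` are morphisms of operads, and the
interchange relation of Boardman and Vogt. -/
inductive Rel (P : Operad.{w₁}) (Q : Operad.{w₂}) {I : Type} {c : I → P.Color × Q.Color} :
    ∀ {d}, BVTerm P Q c d → BVTerm P Q c d → Prop
  | refl {d} (t : BVTerm P Q c d) : Rel P Q t t
  | symm {d} {t t' : BVTerm P Q c d} : Rel P Q t t' → Rel P Q t' t
  | trans {d} {t t' t'' : BVTerm P Q c d} : Rel P Q t t' → Rel P Q t' t'' → Rel P Q t t''
  | left_congr {J : Type} [Finite J] {a : J → P.Color} {a' : P.Color} (b : Q.Color)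
      (p : P.Op a a') {t t' : ∀ j, BVTerm P Q c (a j, b)} :
      (∀ j, Rel P Q (t j) (t' j)) → Rel P Q (left b p t) (left b p t')
  | right_congr {J : Type} [Finite J] {b : J → Q.Color} {b' : Q.Color} (a : P.Color)
      (q : Q.Op b b') {t t' : ∀ j, BVTerm P Q c (a, b j)} :
      (∀ j, Rel P Q (t j) (t' j)) → Rel P Q (right a q t) (right a q t')
  | left_one (a : P.Color) (b : Q.Color) (t : Unit → BVTerm P Q c (a, b)) :
      Rel P Q (left b (P.one a) t) (t ())
  | right_one (a : P.Color) (b : Q.Color) (t : Unit → BVTerm P Q c (a, b)) :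
      Rel P Q (right a (Q.one b) t) (t ())
  | left_reindex {J K : Type} [Finite J] [Finite K] (σ : K ≃ J) {a : J → P.Color} {a' : P.Color}
      (b : Q.Color) (p : P.Op a a') (t : ∀ j, BVTerm P Q c (a j, b)) :
      Rel P Q (left b (P.reindex σ p) (fun k => t (σ k))) (left b p t)
  | right_reindex {J K : Type} [Finite J] [Finite K] (σ : K ≃ J) {b : J → Q.Color} {b' : Q.Color}
      (a : P.Color) (q : Q.Op b b') (t : ∀ j, BVTerm P Q c (a, b j)) :
      Rel P Q (right a (Q.reindex σ q) (fun k => t (σ k))) (right a q t)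
  | left_comp {J : Type} [Finite J] {K : J → Type} [∀ j, Finite (K j)] {a : J → P.Color}
      {a' : P.Color} {e : ∀ j, K j → P.Color} (b : Q.Color) (p : P.Op a a')
      (p' : ∀ j, P.Op (e j) (a j)) (t : ∀ j k, BVTerm P Q c (e j k, b)) :
      Rel P Q (left b (P.comp p p') (fun x => t x.1 x.2))
        (left b p (fun j => left b (p' j) (t j)))
  | right_comp {J : Type} [Finite J] {K : J → Type} [∀ j, Finite (K j)] {b : J → Q.Color}
      {b' : Q.Color} {e : ∀ j, K j → Q.Color} (a : P.Color) (q : Q.Op b b')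
      (q' : ∀ j, Q.Op (e j) (b j)) (t : ∀ j k, BVTerm P Q c (a, e j k)) :
      Rel P Q (right a (Q.comp q q') (fun x => t x.1 x.2))
        (right a q (fun j => right a (q' j) (t j)))
  | interchange {J K : Type} [Finite J] [Finite K] {a : J → P.Color} {a' : P.Color}
      {b : K → Q.Color} {b' : Q.Color} (p : P.Op a a') (q : Q.Op b b')
      (t : ∀ j k, BVTerm P Q c (a j, b k)) :
      Rel P Q (left b' p (fun j => right (a j) q (fun k => t j k)))
        (right a' q (fun k => left (b k) p (fun j => t j k)))

variable {P : Operad.{w₁}} {Q : Operad.{w₂}} {I I' I'' : Type}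
  {c : I → P.Color × Q.Color} {c' : I' → P.Color × Q.Color} {c'' : I'' → P.Color × Q.Color}
  {d : P.Color × Q.Color}

/-- The positions of a term at which a variable occurs. -/
def Pos : ∀ {d}, BVTerm P Q c d → Type
  | _, var _ => Unit
  | _, left _ _ t => Σ j, Pos (t j)
  | _, right _ _ t => Σ j, Pos (t j)

/-- The variable at a position. -/
def label : ∀ {d} (t : BVTerm P Q c d), t.Pos → I
  | _, var i, _ => i
  | _, left _ _ t, x => label (t x.1) x.2
  | _, right _ _ t, x => label (t x.1) x.2

/-- Every variable occurs exactly once. -/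
def Linear (t : BVTerm P Q c d) : Prop := Function.Bijective t.label

/-- Substitution of terms for variables. -/
def subst (s : ∀ i, BVTerm P Q c' (c i)) : ∀ {d}, BVTerm P Q c d → BVTerm P Q c' d
  | _, var i => s i
  | _, left b p t => left b p (fun j => subst s (t j))
  | _, right a q t => right a q (fun j => subst s (t j))

/-- A variable, with its colour given by an equation. -/
def varAt (i : I) (h : c i = d) : BVTerm P Q c d := h ▸ var i

theorem subst_subst (s : ∀ i, BVTerm P Q c' (c i)) (s' : ∀ i, BVTerm P Q c'' (c' i))
    (t : BVTerm P Q c d) :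
    (t.subst s).subst s' = t.subst (fun i => (s i).subst s') := by
  induction t with
  | var i => rfl
  | left b p t ih => simp only [subst, ih]
  | right a q t ih => simp only [subst, ih]

theorem subst_var (t : BVTerm P Q c d) : t.subst (fun i => var i) = t := by
  induction t with
  | var i => rfl
  | left b p t ih => simp only [subst, ih]
  | right a q t ih => simp only [subst, ih]

theorem subst_varAt (s : ∀ i, BVTerm P Q c' (c i)) (i : I) (h : c i = d) :
    (varAt i h : BVTerm P Q c d).subst s = h ▸ s i := by
  subst h; rfl

theorem label_varAt (i : I) (h : c i = d) (x : (varAt i h : BVTerm P Q c d).Pos) :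
    (varAt i h : BVTerm P Q c d).label x = i := by
  subst h; rfl

theorem linear_varAt_unique (i : I) (h : c i = d) (x y : (varAt i h : BVTerm P Q c d).Pos) :
    x = y := by
  subst h; rfl

theorem nonempty_pos_varAt (i : I) (h : c i = d) :
    Nonempty (varAt i h : BVTerm P Q c d).Pos := by
  subst h; exact ⟨()⟩

/-- The positions of a substituted term. -/
def substPos (s : ∀ i, BVTerm P Q c' (c i)) : ∀ {d} (t : BVTerm P Q c d),
    (t.subst s).Pos ≃ Σ x : t.Pos, (s (t.label x)).Pos
  | _, var i => (Equiv.uniqueSigma (fun _ : Unit => (s i).Pos)).symm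
  | _, left _ _ t =>
      (Equiv.sigmaCongrRight fun j => substPos s (t j)).trans
        (Equiv.sigmaAssoc fun j (x : (t j).Pos) => (s ((t j).label x)).Pos).symm
  | _, right _ _ t =>
      (Equiv.sigmaCongrRight fun j => substPos s (t j)).trans
        (Equiv.sigmaAssoc fun j (x : (t j).Pos) => (s ((t j).label x)).Pos).symm

theorem label_subst (s : ∀ i, BVTerm P Q c' (c i)) (t : BVTerm P Q c d) (x : (t.subst s).Pos) :
    (t.subst s).label x =
      (s (t.label (substPos s t x).1)).label (substPos s t x).2 := by
  induction t with
  | var i => rfl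
  | left b p t ih => exact ih x.1 x.2
  | right a q t ih => exact ih x.1 x.2

theorem Linear.subst {t : BVTerm P Q c d} (ht : t.Linear) {s : ∀ i, BVTerm P Q c' (c i)}
    (hs : Function.Bijective (fun y : Σ i, (s i).Pos => (s y.1).label y.2)) :
    (t.subst s).Linear := by
  have e : (t.subst s).label = (fun y : Σ i, (s i).Pos => (s y.1).label y.2) ∘
      (Equiv.sigmaCongrLeft (β := fun i => (s i).Pos) (Equiv.ofBijective _ ht)) ∘
      (substPos s t) := by
    funext x
    exact label_subst s t x
  unfold Linear
  rw [e]
  exact hs.comp ((Equiv.bijective _).comp (Equiv.bijective _))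

theorem Rel.subst_left {t t' : BVTerm P Q c d} (h : Rel P Q t t')
    (s : ∀ i, BVTerm P Q c' (c i)) : Rel P Q (t.subst s) (t'.subst s) := by
  induction h with
  | refl t => exact .refl _
  | symm _ ih => exact ih.symm
  | trans _ _ ih ih' => exact ih.trans ih'
  | left_congr b p _ ih => exact .left_congr b p ih
  | right_congr a q _ ih => exact .right_congr a q ih
  | left_one a b t => exact .left_one a b (fun u => (t u).subst s)
  | right_one a b t => exact .right_one a b (fun u => (t u).subst s)
  | left_reindex σ b p t => exact .left_reindex σ b p (fun j => (t j).subst s)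
  | right_reindex σ a q t => exact .right_reindex σ a q (fun j => (t j).subst s)
  | left_comp b p p' t => exact .left_comp b p p' (fun j k => (t j k).subst s)
  | right_comp a q q' t => exact .right_comp a q q' (fun j k => (t j k).subst s)
  | interchange p q t => exact .interchange p q (fun j k => (t j k).subst s)

theorem Rel.subst_right (t : BVTerm P Q c d) {s s' : ∀ i, BVTerm P Q c' (c i)}
    (h : ∀ i, Rel P Q (s i) (s' i)) : Rel P Q (t.subst s) (t.subst s') := by
  induction t with
  | var i => exact h i
  | left b p t ih => exact .left_congr b p ih
  | right a q t ih => exact .right_congr a q ih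

/-- Relabelling of variables along a bijection. -/
def reindex (σ : I' ≃ I) (t : BVTerm P Q c d) : BVTerm P Q (fun j => c (σ j)) d :=
  t.subst (fun i => varAt (σ.symm i) (congrArg c (σ.apply_symm_apply i)))

/-- Simultaneous grafting of terms with disjoint sets of variables. -/
def comp {J : I → Type} {b : ∀ i, J i → P.Color × Q.Color} (t : BVTerm P Q c d)
    (s : ∀ i, BVTerm P Q (b i) (c i)) : BVTerm P Q (fun x : Σ i, J i => b x.1 x.2) d :=
  t.subst (fun i => (s i).subst (fun j => var (c := fun x : Σ i, J i => b x.1 x.2) ⟨i, j⟩))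

theorem Linear.reindex (σ : I' ≃ I) {t : BVTerm P Q c d} (ht : t.Linear) :
    (t.reindex σ).Linear := by
  refine ht.subst ⟨?_, ?_⟩
  · rintro ⟨i, x⟩ ⟨i', x'⟩ h
    simp only [label_varAt] at h
    obtain rfl := σ.symm.injective h
    rw [linear_varAt_unique _ _ x x']
  · intro j
    obtain ⟨x⟩ := nonempty_pos_varAt (P := P) (Q := Q) (c := fun j => c (σ j)) (σ.symm (σ j))
      (congrArg c (σ.apply_symm_apply (σ j)))
    exact ⟨⟨σ j, x⟩, by simp only [label_varAt, σ.symm_apply_apply]⟩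

theorem Linear.comp {J : I → Type} {b : ∀ i, J i → P.Color × Q.Color} {t : BVTerm P Q c d}
    (ht : t.Linear) {s : ∀ i, BVTerm P Q (b i) (c i)} (hs : ∀ i, (s i).Linear) :
    (t.comp s).Linear := by
  refine ht.subst ⟨?_, ?_⟩
  · rintro ⟨i, x⟩ ⟨i', x'⟩ h
    simp only [label_subst] at h
    have h1 : i = i' := congrArg Sigma.fst h
    subst h1
    have h2 := eq_of_heq (Sigma.mk.inj h).2
    have h3 := (hs i).1 h2
    have h4 : x = x' := (substPos _ _).injective (Sigma.ext h3
      (heq_of_eq (Subsingleton.elim (α := Unit) _ _)))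
    rw [h4]
  · rintro ⟨i, j⟩
    obtain ⟨y, rfl⟩ := (hs i).2 j
    refine ⟨⟨i, (substPos _ _).symm ⟨y, ()⟩⟩, ?_⟩
    refine (label_subst _ _ _).trans ?_
    rw [Equiv.apply_symm_apply]
    rfl

/-- The action of morphisms of operads on terms. -/
def map {P' : Operad.{w₃}} {Q' : Operad.{w₄}} (F : Hom P P') (G : Hom Q Q') :
    ∀ {d}, BVTerm P Q c d → BVTerm P' Q' (fun i => (F.color (c i).1, G.color (c i).2))
      (F.color d.1, G.color d.2)
  | _, var i => var (c := fun i => (F.color (c i).1, G.color (c i).2)) i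
  | _, left b p t => left (G.color b) (F.op p) (fun j => map F G (t j))
  | _, right a q t => right (F.color a) (G.op q) (fun j => map F G (t j))

theorem Rel.map {P' : Operad.{w₃}} {Q' : Operad.{w₄}} (F : Hom P P') (G : Hom Q Q')
    {t t' : BVTerm P Q c d} (h : Rel P Q t t') : Rel P' Q' (t.map F G) (t'.map F G) := by
  induction h with
  | refl t => exact .refl _
  | symm _ ih => exact ih.symm
  | trans _ _ ih ih' => exact ih.trans ih'
  | left_congr b p _ ih => exact .left_congr _ _ ih
  | right_congr a q _ ih => exact .right_congr _ _ ih
  | left_one a b t =>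
    have h := Rel.left_one (Q := Q') (F.color a) (G.color b) (fun u => (t u).map F G)
    rw [← F.op_one] at h
    exact h
  | right_one a b t =>
    have h := Rel.right_one (P := P') (F.color a) (G.color b) (fun u => (t u).map F G)
    rw [← G.op_one] at h
    exact h
  | left_reindex σ b p t =>
    have h := Rel.left_reindex (Q := Q') σ (G.color b) (F.op p) (fun u => (t u).map F G)
    rw [← F.op_reindex] at h
    exact h
  | right_reindex σ a q t =>
    have h := Rel.right_reindex (P := P') σ (F.color a) (G.op q) (fun u => (t u).map F G)
    rw [← G.op_reindex] at h
    exact h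
  | left_comp b p p' t =>
    have h := Rel.left_comp (Q := Q') (G.color b) (F.op p) (fun j => F.op (p' j))
      (fun j k => (t j k).map F G)
    rw [← F.op_comp] at h
    exact h
  | right_comp a q q' t =>
    have h := Rel.right_comp (P := P') (F.color a) (G.op q) (fun j => G.op (q' j))
      (fun j k => (t j k).map F G)
    rw [← G.op_comp] at h
    exact h
  | interchange p q t => exact .interchange (F.op p) (G.op q) (fun j k => (t j k).map F G)

theorem map_subst {P' : Operad.{w₃}} {Q' : Operad.{w₄}} (F : Hom P P') (G : Hom Q Q')
    (s : ∀ i, BVTerm P Q c' (c i)) (t : BVTerm P Q c d) :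
    (t.subst s).map F G = (t.map F G).subst (fun i => (s i).map F G) := by
  induction t with
  | var i => rfl
  | left b p t ih => simp only [subst, map, ih]
  | right a q t ih => simp only [subst, map, ih]

theorem map_varAt {P' : Operad.{w₃}} {Q' : Operad.{w₄}} (F : Hom P P') (G : Hom Q Q')
    (i : I) (h : c i = d) : (varAt i h : BVTerm P Q c d).map F G =
      varAt (c := fun i => (F.color (c i).1, G.color (c i).2)) i (by rw [h]) := by
  subst h; rfl

theorem map_reindex {P' : Operad.{w₃}} {Q' : Operad.{w₄}} (F : Hom P P') (G : Hom Q Q')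
    (σ : I' ≃ I) (t : BVTerm P Q c d) : (t.reindex σ).map F G = (t.map F G).reindex σ := by
  unfold reindex
  rw [map_subst]
  refine congrArg (fun r => BVTerm.subst r (t.map F G)) (funext fun i => ?_)
  exact map_varAt F G _ _

theorem map_comp {P' : Operad.{w₃}} {Q' : Operad.{w₄}} (F : Hom P P') (G : Hom Q Q')
    {J : I → Type} {b : ∀ i, J i → P.Color × Q.Color} (t : BVTerm P Q c d)
    (s : ∀ i, BVTerm P Q (b i) (c i)) :
    (t.comp s).map F G = (t.map F G).comp (fun i => (s i).map F G) := by
  unfold comp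
  rw [map_subst]
  refine congrArg (fun r => BVTerm.subst r (t.map F G)) (funext fun i => ?_)
  exact map_subst F G _ _

/-- The map on positions induced by morphisms of operads. -/
def mapPos {P' : Operad.{w₃}} {Q' : Operad.{w₄}} (F : Hom P P') (G : Hom Q Q') :
    ∀ {d} (t : BVTerm P Q c d), (t.map F G).Pos ≃ t.Pos
  | _, var _ => Equiv.refl Unit
  | _, left _ _ t => Equiv.sigmaCongrRight fun j => mapPos F G (t j)
  | _, right _ _ t => Equiv.sigmaCongrRight fun j => mapPos F G (t j)

theorem Linear.map {P' : Operad.{w₃}} {Q' : Operad.{w₄}} (F : Hom P P') (G : Hom Q Q')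
    {t : BVTerm P Q c d} (ht : t.Linear) : (t.map F G).Linear := by
  have e : (t.map F G).label = t.label ∘ mapPos F G t := by
    clear ht
    induction t with
    | var i => rfl
    | left b p t ih => funext x; exact congrFun (ih x.1) x.2
    | right a q t ih => funext x; exact congrFun (ih x.1) x.2
  unfold Linear
  rw [e]
  exact Function.Bijective.comp ht (Equiv.bijective _)

theorem cast_varAt {e : P.Color × Q.Color} (i : I) (h : c i = d) (h' : d = e) :
    (h' ▸ (varAt i h : BVTerm P Q c d) : BVTerm P Q c e) = varAt i (h.trans h') := by
  subst h'; rfl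

theorem varAt_congr {i i' : I} (e : i = i') (h : c i = d) (h' : c i' = d) :
    (varAt i h : BVTerm P Q c d) = varAt i' h' := by
  subst e; rfl

theorem linear_var : (var () : BVTerm P Q (fun _ : Unit => d) d).Linear :=
  ⟨fun _ _ _ => rfl, fun _ => ⟨(), rfl⟩⟩

theorem reindex_refl (t : BVTerm P Q c d) : t.reindex (Equiv.refl I) = t := subst_var t

theorem reindex_trans (σ : I' ≃ I) (τ : I'' ≃ I') (t : BVTerm P Q c d) :
    (t.reindex σ).reindex τ = t.reindex (τ.trans σ) := by
  unfold reindex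
  rw [subst_subst]
  congr 1
  funext i
  rw [subst_varAt, cast_varAt]
  rfl

theorem comp_assoc {J : I → Type} {K : ∀ i, J i → Type} {b : ∀ i, J i → P.Color × Q.Color}
    {a : ∀ i j, K i j → P.Color × Q.Color} (t : BVTerm P Q c d)
    (s : ∀ i, BVTerm P Q (b i) (c i)) (r : ∀ i j, BVTerm P Q (a i j) (b i j)) :
    (t.comp s).comp (fun x => r x.1 x.2) =
      (t.comp (fun i => (s i).comp (r i))).reindex (Equiv.sigmaAssoc K) := by
  simp only [comp, reindex, subst_subst]
  rfl

theorem comp_reindex_left {J : I → Type} (σ : I' ≃ I) {b : ∀ i, J i → P.Color × Q.Color}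
    (t : BVTerm P Q c d) (s : ∀ i, BVTerm P Q (b i) (c i)) :
    (t.reindex σ).comp (fun i => s (σ i)) =
      (t.comp s).reindex (Equiv.sigmaCongrLeft (β := J) σ) := by
  simp only [comp, reindex, subst_subst, subst_varAt]
  congr 1
  funext i
  have key : ∀ (k : I') (h : σ k = i) (h' : c (σ k) = c i),
      (h' ▸ (s (σ k)).subst (fun j => var (c := fun x : Σ i, J (σ i) => b (σ x.1) x.2) ⟨k, j⟩) :
        BVTerm P Q (fun x : Σ i, J (σ i) => b (σ x.1) x.2) (c i)) =
      (s i).subst (fun j => varAt (c := fun x : Σ i, J (σ i) => b (σ x.1) x.2)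
        ((Equiv.sigmaCongrLeft (β := J) σ).symm ⟨i, j⟩)
        (congrArg (fun x : Σ i, J i => b x.1 x.2)
          ((Equiv.sigmaCongrLeft (β := J) σ).apply_symm_apply ⟨i, j⟩))) := by
    intro k h h'
    subst h
    refine congrArg (fun r => BVTerm.subst r (s (σ k))) (funext fun j => ?_)
    exact varAt_congr ((Equiv.sigmaCongrLeft (β := J) σ).symm_apply_apply ⟨k, j⟩).symm rfl _
  exact key (σ.symm i) (σ.apply_symm_apply i) _

theorem comp_reindex_right {J J' : I → Type} (τ : ∀ i, J' i ≃ J i)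
    {b : ∀ i, J i → P.Color × Q.Color} (t : BVTerm P Q c d) (s : ∀ i, BVTerm P Q (b i) (c i)) :
    t.comp (fun i => (s i).reindex (τ i)) =
      (t.comp s).reindex (Equiv.sigmaCongrRight τ) := by
  simp only [comp, reindex, subst_subst, subst_varAt]
  refine congrArg (fun r => BVTerm.subst r t) (funext fun i => ?_)
  refine congrArg (fun r => BVTerm.subst r (s i)) (funext fun j => ?_)
  exact cast_varAt (c := fun x : Σ i, J' i => b x.1 (τ x.1 x.2)) ⟨i, (τ i).symm j⟩ rfl _

end BVTerm

/-- Linear terms up to the Boardman–Vogt relations. -/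
def bvSetoid (P : Operad.{w₁}) (Q : Operad.{w₂}) {I : Type} (c : I → P.Color × Q.Color)
    (d : P.Color × Q.Color) : Setoid {t : BVTerm P Q c d // t.Linear} where
  r t t' := BVTerm.Rel P Q t.1 t'.1
  iseqv := ⟨fun t => .refl t.1, fun h => h.symm, fun h h' => h.trans h'⟩

/-- Composition in the Boardman–Vogt tensor product. -/
noncomputable def bvComp (P : Operad.{w₁}) (Q : Operad.{w₂}) {I : Type} {J : I → Type}
    {c : I → P.Color × Q.Color} {d : P.Color × Q.Color} {b : ∀ i, J i → P.Color × Q.Color}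
    (p : Quotient (bvSetoid P Q c d)) (q : ∀ i, Quotient (bvSetoid P Q (b i) (c i))) :
    Quotient (bvSetoid P Q (fun x : Σ i, J i => b x.1 x.2) d) :=
  Quotient.mk _ ⟨p.out.1.comp fun i => (q i).out.1, p.out.2.comp fun i => (q i).out.2⟩

theorem bvComp_mk (P : Operad.{w₁}) (Q : Operad.{w₂}) {I : Type} {J : I → Type}
    {c : I → P.Color × Q.Color} {d : P.Color × Q.Color} {b : ∀ i, J i → P.Color × Q.Color}
    (t : {t : BVTerm P Q c d // t.Linear})
    (s : ∀ i, {t : BVTerm P Q (b i) (c i) // t.Linear}) :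
    bvComp P Q (Quotient.mk (bvSetoid P Q c d) t)
        (fun i => Quotient.mk (bvSetoid P Q (b i) (c i)) (s i)) =
      Quotient.mk (bvSetoid P Q (fun x : Σ i, J i => b x.1 x.2) d)
        ⟨t.1.comp fun i => (s i).1, t.2.comp fun i => (s i).2⟩ := by
  apply Quotient.sound
  have h := Quotient.exact (Quotient.out_eq (Quotient.mk (bvSetoid P Q c d) t))
  have h' := fun i =>
    Quotient.exact (Quotient.out_eq (Quotient.mk (bvSetoid P Q (b i) (c i)) (s i)))
  exact (BVTerm.Rel.subst_left h _).trans
    (BVTerm.Rel.subst_right _ fun i => BVTerm.Rel.subst_left (h' i) _)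

/-- Relabelling in the Boardman–Vogt tensor product. -/
def bvReindex (P : Operad.{w₁}) (Q : Operad.{w₂}) {I J : Type} (σ : J ≃ I)
    {c : I → P.Color × Q.Color} {d : P.Color × Q.Color} (p : Quotient (bvSetoid P Q c d)) :
    Quotient (bvSetoid P Q (fun j => c (σ j)) d) :=
  Quotient.map' (s₁ := bvSetoid P Q c d) (s₂ := bvSetoid P Q (fun j => c (σ j)) d)
    (fun t => ⟨t.1.reindex σ, t.2.reindex σ⟩)
    (fun _ _ h => BVTerm.Rel.subst_left h _) p

/-- The Boardman–Vogt tensor product of coloured symmetric operads. -/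
noncomputable def bv (P : Operad.{w₁}) (Q : Operad.{w₂}) : Operad.{max 1 w₁ w₂} where
  Color := P.Color × Q.Color
  Op := fun {I} _ c d => Quotient (bvSetoid P Q (I := I) c d)
  one c := Quotient.mk _ ⟨BVTerm.var (c := fun _ : Unit => c) (), BVTerm.linear_var⟩
  reindex σ := fun p => bvReindex P Q σ p
  comp := fun p q => bvComp P Q p q
  reindex_refl p := by
    induction p using Quotient.inductionOn with
    | h t => exact congrArg (Quotient.mk _) (Subtype.ext (BVTerm.reindex_refl t.1))
  reindex_trans σ τ _ _ p := by
    induction p using Quotient.inductionOn with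
    | h t => exact congrArg (Quotient.mk _) (Subtype.ext (BVTerm.reindex_trans σ τ t.1))
  one_comp p := by
    induction p using Quotient.inductionOn with
    | h t => exact (bvComp_mk P Q _ (fun _ => t)).trans rfl
  comp_one p := by
    induction p using Quotient.inductionOn with
    | h t => exact (bvComp_mk P Q t
        (fun i => ⟨BVTerm.var (c := fun _ : Unit => _) (), BVTerm.linear_var⟩)).trans rfl
  assoc p q r := by
    obtain ⟨t, rfl⟩ := Quotient.exists_rep p
    choose s hs using fun i => Quotient.exists_rep (q i)
    choose u hu using fun i j => Quotient.exists_rep (r i j)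
    obtain rfl : (fun i => Quotient.mk _ (s i)) = q := funext hs
    obtain rfl : (fun i j => Quotient.mk _ (u i j)) = r := funext fun i => funext (hu i)
    simp only [bvComp_mk]
    exact congrArg (Quotient.mk _) (Subtype.ext
      (BVTerm.comp_assoc t.1 (fun i => (s i).1) (fun i j => (u i j).1)))
  comp_reindex_left σ _ _ _ p q := by
    obtain ⟨t, rfl⟩ := Quotient.exists_rep p
    choose s hs using fun i => Quotient.exists_rep (q i)
    obtain rfl : (fun i => Quotient.mk _ (s i)) = q := funext hs
    rw [bvComp_mk]
    exact (bvComp_mk P Q ⟨t.1.reindex σ, t.2.reindex σ⟩ (fun i => s (σ i))).trans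
      (congrArg (Quotient.mk _) (Subtype.ext
        (BVTerm.comp_reindex_left σ t.1 (fun i => (s i).1))))
  comp_reindex_right τ _ _ _ p q := by
    obtain ⟨t, rfl⟩ := Quotient.exists_rep p
    choose s hs using fun i => Quotient.exists_rep (q i)
    obtain rfl : (fun i => Quotient.mk _ (s i)) = q := funext hs
    rw [bvComp_mk]
    exact (bvComp_mk P Q t (fun i => ⟨(s i).1.reindex (τ i), (s i).2.reindex (τ i)⟩)).trans
      (congrArg (Quotient.mk _) (Subtype.ext
        (BVTerm.comp_reindex_right τ t.1 (fun i => (s i).1))))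

/-- Functoriality of the Boardman–Vogt tensor product. -/
noncomputable def bvMap {P : Operad.{w₁}} {Q : Operad.{w₂}} {P' : Operad.{w₃}}
    {Q' : Operad.{w₄}} (F : Hom P P') (G : Hom Q Q') : Hom (bv P Q) (bv P' Q') where
  color := fun c => (F.color c.1, G.color c.2)
  op := fun {I} _ {c d} => Quotient.map' (s₁ := bvSetoid P Q c d)
    (s₂ := bvSetoid P' Q' (fun i => (F.color (c i).1, G.color (c i).2))
      (F.color d.1, G.color d.2))
    (fun t => ⟨t.1.map F G, t.2.map F G⟩) (fun _ _ h => h.map F G)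
  op_one _ := rfl
  op_reindex σ _ _ p := by
    obtain ⟨t, rfl⟩ := Quotient.exists_rep p
    refine congrArg (Quotient.mk _) (Subtype.ext ?_)
    exact BVTerm.map_reindex F G σ t.1
  op_comp p q := by
    obtain ⟨t, rfl⟩ := Quotient.exists_rep p
    choose s hs using fun i => Quotient.exists_rep (q i)
    obtain rfl : (fun i => Quotient.mk _ (s i)) = q := funext hs
    refine (congrArg _ (bvComp_mk P Q t s)).trans ?_
    refine Eq.trans ?_ (bvComp_mk P' Q' ⟨t.1.map F G, t.2.map F G⟩
      (fun i => ⟨(s i).1.map F G, (s i).2.map F G⟩)).symm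
    refine congrArg (Quotient.mk _) (Subtype.ext ?_)
    exact BVTerm.map_comp F G t.1 (fun i => (s i).1)

theorem Hom.ext_op {P : Operad.{w₁}} {Q : Operad.{w₂}} {F G : Hom P Q}
    (h : F.color = G.color)
    (h' : ∀ (I : Type) [Finite I] (c : I → P.Color) (d : P.Color) (p : P.Op c d),
      F.op p ≍ G.op p) : F = G := by
  obtain ⟨f, o, _, _, _⟩ := F
  obtain ⟨f', o', _, _, _⟩ := G
  obtain rfl : f = f' := h
  obtain rfl : @o = @o' := by
    funext I _ c d p
    exact eq_of_heq (h' I c d p)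
  rfl

theorem BVTerm.map_id {P : Operad.{w₁}} {Q : Operad.{w₂}} {I : Type}
    {c : I → P.Color × Q.Color} {d : P.Color × Q.Color} (t : BVTerm P Q c d) :
    t.map (Hom.id P) (Hom.id Q) = t := by
  induction t with
  | var i => rfl
  | left b p t ih => exact congrArg (BVTerm.left b p) (funext ih)
  | right a q t ih => exact congrArg (BVTerm.right a q) (funext ih)

theorem BVTerm.map_map {P : Operad.{w₁}} {Q : Operad.{w₂}} {P' Q' P'' Q'' : Operad.{w}} {I : Type}
    {c : I → P.Color × Q.Color} {d : P.Color × Q.Color} (F : Hom P P') (F' : Hom P' P'')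
    (G : Hom Q Q') (G' : Hom Q' Q'') (t : BVTerm P Q c d) :
    t.map (F.comp F') (G.comp G') = (t.map F G).map F' G' := by
  induction t with
  | var i => rfl
  | left b p t ih => exact congrArg (BVTerm.left (G'.color (G.color b)) (F'.op (F.op p))) (funext ih)
  | right a q t ih =>
    exact congrArg (BVTerm.right (F'.color (F.color a)) (G'.op (G.op q))) (funext ih)

theorem bvMap_id (P : Operad.{w₁}) (Q : Operad.{w₂}) :
    bvMap (Hom.id P) (Hom.id Q) = Hom.id (bv P Q) := by
  refine Hom.ext_op rfl fun I _ c d p => heq_of_eq ?_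
  obtain ⟨t, rfl⟩ := Quotient.exists_rep p
  exact congrArg (Quotient.mk _) (Subtype.ext (BVTerm.map_id t.1))

theorem bvMap_comp {P : Operad.{w₁}} {Q : Operad.{w₂}} {P' Q' P'' Q'' : Operad.{w}}
    (F : Hom P P') (F' : Hom P' P'') (G : Hom Q Q') (G' : Hom Q' Q'') :
    bvMap (F.comp F') (G.comp G') = (bvMap F G).comp (bvMap F' G') := by
  refine Hom.ext_op rfl fun I _ c d p => heq_of_eq ?_
  obtain ⟨t, rfl⟩ := Quotient.exists_rep p
  exact congrArg (Quotient.mk _) (Subtype.ext (BVTerm.map_map F F' G G' t.1))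

end Operad

/-! ### Trees and dendroidal sets -/

/-- A finite rooted tree (without planar structure). Each vertex `v` has an output edge `out v`;
`target e` is the vertex of which the edge `e` is an input, if there is one, and only the root
edge is not an input of a vertex. An edge that is not of the form `out v` is a leaf. Vertices
without inputs are allowed, and so is the tree with one edge and no vertex. -/
structure Tree where
  Edge : Type
  Vert : Type
  finite_edge : Finite Edge
  root : Edge
  out : Vert → Edge
  out_injective : Function.Injective out
  target : Edge → Option Vert
  target_eq_none : ∀ e, target e = none ↔ e = root
  to_root : ∀ e,
    Relation.ReflTransGen (fun e d => ∃ v, target e = some v ∧ out v = d) e root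

namespace Tree

/-- `d` is the output of the vertex of which `e` is an input. -/
def Parent (T : Tree) (e d : T.Edge) : Prop := ∃ v, T.target e = some v ∧ T.out v = d

/-- The strict order on edges: `d` is different from `e` and lies on the path from `e` to
the root. -/
def Lt (T : Tree) (d e : T.Edge) : Prop := Relation.TransGen T.Parent e d

/-- `T.IsSubtree L e`: some subtree of `T` has root `e` and set of leaves `L`. Such a subtree is
either the edge `e`, or it has a lowest vertex `v` with output `e` and a subtree on top of each
input of `v`. -/
inductive IsSubtree (T : Tree) : Set T.Edge → T.Edge → Prop
  | edge (e : T.Edge) : IsSubtree T {e} e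
  | vertex (v : T.Vert) (L : {a : T.Edge // T.target a = some v} → Set T.Edge)
      (h : ∀ a, IsSubtree T (L a) a.1) : IsSubtree T (⋃ a, L a) (T.out v)

variable {T : Tree}

theorem parent_rightUnique : Relator.RightUnique T.Parent := by
  rintro a b c ⟨v, hv, rfl⟩ ⟨v', hv', rfl⟩
  rw [hv] at hv'
  cases hv'
  rfl

theorem not_transGen_self (e : T.Edge) : ¬ Relation.TransGen T.Parent e e := by
  intro h
  have key : ∀ d, Relation.ReflTransGen T.Parent e d → Relation.TransGen T.Parent d d := by
    intro d hd
    induction hd with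
    | refl => exact h
    | tail _ hbc ih =>
      obtain ⟨x, hx, hx'⟩ := Relation.TransGen.head'_iff.1 ih
      obtain rfl := parent_rightUnique hx hbc
      exact Relation.TransGen.tail' hx' hbc
  obtain ⟨x, ⟨v, hv, -⟩, -⟩ := Relation.TransGen.head'_iff.1 (key T.root (T.to_root e))
  rw [(T.target_eq_none _).2 rfl] at hv
  cases hv

theorem IsSubtree.le {L : Set T.Edge} {e : T.Edge} (h : T.IsSubtree L e) {x : T.Edge}
    (hx : x ∈ L) : Relation.ReflTransGen T.Parent x e := by
  induction h with
  | edge e => rw [Set.mem_singleton_iff.1 hx]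
  | vertex v L h ih =>
    obtain ⟨a, ha⟩ := Set.mem_iUnion.1 hx
    exact (ih a ha).tail ⟨v, a.2, rfl⟩

theorem IsSubtree.antichain {L : Set T.Edge} {e : T.Edge} (h : T.IsSubtree L e) {x y : T.Edge}
    (hx : x ∈ L) (hy : y ∈ L) (hxy : Relation.ReflTransGen T.Parent x y) : x = y := by
  induction h with
  | edge e => rw [Set.mem_singleton_iff.1 hx, Set.mem_singleton_iff.1 hy]
  | vertex v L h ih =>
    have key : ∀ a b : {a : T.Edge // T.target a = some v},
        Relation.ReflTransGen T.Parent a.1 b.1 → a = b := by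
      intro a b hab
      rcases Relation.ReflTransGen.cases_head hab with h' | ⟨d, hd, hdb⟩
      · exact Subtype.ext h'
      · obtain rfl := parent_rightUnique hd ⟨v, a.2, rfl⟩
        exact (not_transGen_self b.1 (Relation.TransGen.head' ⟨v, b.2, rfl⟩ hdb)).elim
    obtain ⟨a, ha⟩ := Set.mem_iUnion.1 hx
    obtain ⟨b, hb⟩ := Set.mem_iUnion.1 hy
    have hab : a = b := by
      rcases Relation.ReflTransGen.total_of_right_unique parent_rightUnique
        ((h a).le ha) (hxy.trans ((h b).le hb)) with h' | h'
      · exact key a b h'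
      · exact (key b a h').symm
    subst hab
    exact ih a ha hb

theorem IsSubtree.graft {L : Set T.Edge} {e : T.Edge} (h : T.IsSubtree L e)
    (M : T.Edge → Set T.Edge) (hM : ∀ x ∈ L, T.IsSubtree (M x) x) :
    T.IsSubtree (⋃ x ∈ L, M x) e := by
  induction h with
  | edge e => simpa using hM e rfl
  | vertex v L h ih =>
    have : (⋃ x ∈ ⋃ a, L a, M x) = ⋃ a, ⋃ x ∈ L a, M x := by
      ext y
      simp only [Set.mem_iUnion, exists_prop]
      constructor
      · rintro ⟨x, ⟨a, ha⟩, hy⟩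
        exact ⟨a, x, ha, hy⟩
      · rintro ⟨a, x, ha, hy⟩
        exact ⟨x, ⟨a, ha⟩, hy⟩
    rw [this]
    exact .vertex v _ fun a => ih a fun x hx => hM x (Set.mem_iUnion.2 ⟨a, hx⟩)

theorem isSubtree_comp {I : Type} {J : I → Type} {c : I → T.Edge} {d : T.Edge}
    {b : ∀ i, J i → T.Edge} (hc : Function.Injective c) (h : T.IsSubtree (Set.range c) d)
    (hb : ∀ i, Function.Injective (b i)) (h' : ∀ i, T.IsSubtree (Set.range (b i)) (c i)) :
    Function.Injective (fun x : Σ i, J i => b x.1 x.2) ∧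
      T.IsSubtree (Set.range (fun x : Σ i, J i => b x.1 x.2)) d := by
  constructor
  · rintro ⟨i, j⟩ ⟨i', j'⟩ e
    dsimp only at e
    have hi : i = i' := by
      have h1 := (h' i).le ⟨j, rfl⟩
      have h2 := (h' i').le ⟨j', rfl⟩
      rw [← e] at h2
      rcases Relation.ReflTransGen.total_of_right_unique parent_rightUnique h1 h2 with h3 | h3
      · exact hc (h.antichain ⟨i, rfl⟩ ⟨i', rfl⟩ h3)
      · exact (hc (h.antichain ⟨i', rfl⟩ ⟨i, rfl⟩ h3)).symm
    subst hi
    rw [hb i e]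
  · have h1 := h.graft (fun x => ⋃ i, ⋃ (_ : c i = x), Set.range (b i)) (by
      rintro _ ⟨i, rfl⟩
      have : (⋃ i', ⋃ (_ : c i' = c i), Set.range (b i')) = Set.range (b i) := by
        ext y
        simp only [Set.mem_iUnion, exists_prop]
        constructor
        · rintro ⟨i', hi, hy⟩
          obtain rfl := hc hi
          exact hy
        · exact fun hy => ⟨i, rfl, hy⟩
      rw [this]
      exact h' i)
    have : Set.range (fun x : Σ i, J i => b x.1 x.2) =
        ⋃ x ∈ Set.range c, ⋃ i, ⋃ (_ : c i = x), Set.range (b i) := by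
      ext y
      simp only [Set.mem_iUnion, exists_prop, Set.mem_range]
      constructor
      · rintro ⟨⟨i, j⟩, rfl⟩
        exact ⟨c i, ⟨i, rfl⟩, i, rfl, j, rfl⟩
      · rintro ⟨x, -, i, -, j, rfl⟩
        exact ⟨⟨i, j⟩, rfl⟩
    rw [this]
    exact h1

/-- The operad `Ω(T)` freely generated by the vertices of the tree `T`. Its colours are the edges
of `T`, and it has exactly one operation with given inputs and output if there is a subtree with
these leaves (without repetition) and this root, and none otherwise. -/
def operad (T : Tree) : Operad.{0} where
  Color := T.Edge
  Op := fun {I} _ c d => PLift (Function.Injective c ∧ T.IsSubtree (Set.range c) d)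
  one c := ⟨fun _ _ _ => rfl, by rw [Set.range_const]; exact .edge c⟩
  reindex σ c d p := ⟨p.down.1.comp σ.injective, by
    have h := p.down.2
    rwa [← σ.surjective.range_comp c] at h⟩
  comp p q := ⟨isSubtree_comp p.down.1 p.down.2 (fun i => (q i).down.1) (fun i => (q i).down.2)⟩
  reindex_refl := by intros; rfl
  reindex_trans := by intros; rfl
  one_comp := by intros; rfl
  comp_one := by intros; rfl
  assoc := by intros; rfl
  comp_reindex_left := by intros; rfl
  comp_reindex_right := by intros; rfl

/-- The category `Ω` of trees: morphisms `S ⟶ T` are the morphisms of operads `Ω(S) → Ω(T)`. -/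
instance : Category.{1} Tree where
  Hom S T := Operad.Hom S.operad T.operad
  id T := Operad.Hom.id T.operad
  comp f g := Operad.Hom.comp f g

/-- The map on edges underlying a morphism of trees. -/
def edgeMap {S T : Tree} (f : S ⟶ T) : S.Edge → T.Edge := Operad.Hom.color f

end Tree

/-- The category of dendroidal sets, i.e. presheaves on `Ω`. -/
abbrev DSet := Treeᵒᵖ ⥤ Type 1

/-- The dendroidal set `Ω[T]` represented by a tree. -/
abbrev representable (T : Tree) : DSet := yoneda.obj T

/-- The dendroidal nerve of an operad: its dendrices of shape `R` are the morphisms of operads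
`Ω(R) → P`. -/
def nerve (P : Operad.{1}) : DSet where
  obj R := Operad.Hom R.unop.operad P
  map f := ↾ fun F => Operad.Hom.comp (P := (Opposite.unop _ : Tree).operad) f.unop F

/-- Functoriality of the dendroidal nerve. -/
def nerveMap {P Q : Operad.{1}} (F : Operad.Hom P Q) : nerve P ⟶ nerve Q where
  app R := ↾ fun G => Operad.Hom.comp G F

/-- The operad of the linear tree `[n]`, with edges `0, …, n` and root `0`. -/
abbrev linearOperad (n : SimplexCategory) : Operad.{0} := Operad.ofPreorder (Fin (n.len + 1))

/-- The functor sending `T` and `[n]` to the dendroidal nerve of the Boardman–Vogt tensor product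
of the operads of `[n]` and `T`. -/
noncomputable def simplexTensor : Tree ⥤ SimplexCategory ⥤ DSet where
  obj T :=
    { obj := fun n => nerve (Operad.bv (linearOperad n) T.operad)
      map := fun α => nerveMap (Operad.bvMap (Operad.ofPreorderMap α.toOrderHom)
        (Operad.Hom.id T.operad))
      map_id := fun n => by
        exact congrArg nerveMap (Operad.bvMap_id (linearOperad n) T.operad)
      map_comp := fun α β => by
        exact congrArg nerveMap (Operad.bvMap_comp (Operad.ofPreorderMap α.toOrderHom)
          (Operad.ofPreorderMap β.toOrderHom) (Operad.Hom.id T.operad)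
          (Operad.Hom.id T.operad)) }
  map u :=
    { app := fun n => nerveMap (Operad.bvMap (Operad.Hom.id (linearOperad n)) u)
      naturality := fun m n α => by
        exact (congrArg nerveMap (Operad.bvMap_comp (Operad.ofPreorderMap α.toOrderHom)
          (Operad.Hom.id (linearOperad n)) (Operad.Hom.id _) u)).symm.trans
          (congrArg nerveMap (Operad.bvMap_comp (Operad.Hom.id (linearOperad m))
            (Operad.ofPreorderMap α.toOrderHom) u (Operad.Hom.id _))) }
  map_id T := by
    ext n : 2
    exact congrArg nerveMap (Operad.bvMap_id (linearOperad n) T.operad)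
  map_comp u v := by
    ext n : 2
    exact congrArg nerveMap (Operad.bvMap_comp (Operad.Hom.id (linearOperad n))
      (Operad.Hom.id (linearOperad n)) u v)

instance hasLeftKanExtension (F : SimplexCategory ⥤ DSet) :
    SSet.stdSimplex.{0}.HasLeftKanExtension F :=
  (Functor.pointwiseLeftKanExtensionIsPointwiseLeftKanExtension
    SSet.stdSimplex.{0} F).hasLeftKanExtension

/-- The tensor product `X ⊗ Ω[T]` of a simplicial set `X` (regarded as a dendroidal set) and a
representable dendroidal set: the extension of `Δ[n] ⊗ Ω[T]`, the dendroidal nerve of the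
Boardman–Vogt tensor product, that preserves colimits in `X`. -/
noncomputable def tensor : Tree ⥤ SSet.{0} ⥤ DSet := simplexTensor ⋙ SSet.stdSimplex.lan

/-- The dendroidal set `Δ[n] ⊗ Ω[T]`. -/
noncomputable abbrev stdTensor (n : ℕ) (T : Tree) : DSet :=
  (tensor.obj T).obj (SSet.stdSimplex.obj (SimplexCategory.mk n))

/-- The canonical isomorphism from the dendroidal nerve of the Boardman–Vogt tensor product of the
operads of `[n]` and `T` to `Δ[n] ⊗ Ω[T]`. -/
noncomputable def stdTensorUnit (n : ℕ) (T : Tree) :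
    nerve (Operad.bv (linearOperad (SimplexCategory.mk n)) T.operad) ⟶ stdTensor n T :=
  (SSet.stdSimplex.lanUnit.app (simplexTensor.obj T)).app (SimplexCategory.mk n)

theorem isIso_stdTensorUnit (n : ℕ) (T : Tree) : IsIso (stdTensorUnit n T) :=
  have : (SSet.stdSimplex.{0} : SimplexCategory ⥤ SSet).Full := SSet.stdSimplex.fullyFaithful.full
  (Functor.isPointwiseLeftKanExtensionLeftKanExtensionUnit SSet.stdSimplex.{0}
    (simplexTensor.obj T) (SSet.stdSimplex.obj (SimplexCategory.mk n))).isIso_hom_app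

/-- The map `X ⊗ Ω[T] → Δ[n] ⊗ Ω[T]` for a simplicial subset `X` of `Δ[n]`. -/
noncomputable def subTensorMap (n : ℕ) (T : Tree)
    (X : (SSet.stdSimplex.{0}.obj (SimplexCategory.mk n)).Subcomplex) :
    (tensor.obj T).obj X.toSSet ⟶ stdTensor n T :=
  (tensor.obj T).map X.ι

/-- The map `Δ[n] ⊗ Ω[F] → Δ[n] ⊗ Ω[T]` induced by a morphism of trees `F ⟶ T`. -/
noncomputable def stdTensorMap (n : ℕ) {F T : Tree} (v : F ⟶ T) : stdTensor n F ⟶ stdTensor n T :=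
  (tensor.map v).app (SSet.stdSimplex.obj (SimplexCategory.mk n))

/-- The face `∂_i[n]` of `Δ[n]` opposite to the vertex `i`. -/
def oppFace (n : ℕ) (i : Fin (n + 1)) :
    (SSet.stdSimplex.{0}.obj (SimplexCategory.mk n)).Subcomplex :=
  SSet.stdSimplex.face {i}ᶜ

/-- `f` factors through `j`. -/
def FactorsThrough {C : Type*} [Category C] {X Y Z : C} (f : X ⟶ Z) (j : Y ⟶ Z) : Prop :=
  ∃ g : X ⟶ Y, g ≫ j = f

/-! ### Monomorphisms into `Δ[n] ⊗ Ω[T]` and faces with height functions -/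

/-- A height function on `S` with values in `{0, …, n}`: every edge has a nonempty set of values,
and these sets are monotone with respect to the order of the edges. -/
structure HeightFunction (n : ℕ) (S : Tree) where
  val : S.Edge → Set (Fin (n + 1))
  nonempty : ∀ e, (val e).Nonempty
  monotone : ∀ e e', S.Lt e e' → ∀ i ∈ val e, ∀ i' ∈ val e', i ≤ i'

/-- A monomorphism from a representable dendroidal set to `Δ[n] ⊗ Ω[T]`. -/
structure TreeMono (n : ℕ) (T : Tree) where
  tree : Tree
  hom : representable tree ⟶ stdTensor n T
  mono : Mono hom

/-- Monomorphisms are identified if they differ by an isomorphism of their sources. -/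
instance TreeMono.setoid (n : ℕ) (T : Tree) : Setoid (TreeMono n T) where
  r m m' := ∃ φ : m.tree ≅ m'.tree, yoneda.map φ.hom ≫ m'.hom = m.hom
  iseqv :=
    { refl := fun m => ⟨Iso.refl _, by simp⟩
      symm := by
        rintro m m' ⟨φ, h⟩
        exact ⟨φ.symm, by rw [← h, ← Category.assoc, ← yoneda.map_comp]; simp⟩
      trans := by
        rintro m m' m'' ⟨φ, h⟩ ⟨ψ, h'⟩
        exact ⟨φ ≪≫ ψ, by rw [← h, ← h']; simp⟩ }

/-- A face `u : S ↣ T`, i.e. a monomorphism of trees, with a height function on `S`. -/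
structure HeightFace (n : ℕ) (T : Tree) where
  tree : Tree
  face : tree ⟶ T
  mono : Mono face
  height : HeightFunction n tree

/-- Pairs of a face and a height function are identified if they differ by an isomorphism of the
sources of the faces. -/
instance HeightFace.setoid (n : ℕ) (T : Tree) : Setoid (HeightFace n T) where
  r p p' := ∃ φ : p.tree ≅ p'.tree, φ.hom ≫ p'.face = p.face ∧
    ∀ e, p'.height.val (Tree.edgeMap φ.hom e) = p.height.val e
  iseqv :=
    { refl := fun p => ⟨Iso.refl _, Category.id_comp _, fun _ => rfl⟩
      symm := by
        rintro p p' ⟨φ, h, h'⟩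
        refine ⟨φ.symm, by rw [← h]; simp, fun e => ?_⟩
        have := congrArg (fun f => Tree.edgeMap f e) φ.inv_hom_id
        rw [Iso.symm_hom, ← h']
        exact congrArg _ this
      trans := by
        rintro p p' p'' ⟨φ, h, h'⟩ ⟨ψ, k, k'⟩
        exact ⟨φ ≪≫ ψ, by rw [← h, ← k]; simp, fun e => (k' _).trans (h' e)⟩ }

/-- The relation between a monomorphism `Ω[S'] ↣ Δ[n] ⊗ Ω[T]`, with associated map `x ↦ (i, t)`
on edges, and a face `u : S ↣ T` with height function `h`: the map `x ↦ t` is `u ∘ σ` for a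
degeneracy (i.e. a split epimorphism of trees) `σ : S' ↠ S`, and `h e` is the set of the
heights of the edges in the inverse image of `e` under `σ`. -/
def Corresponds {n : ℕ} {T : Tree} (m : TreeMono n T) (p : HeightFace n T) : Prop :=
  ∃ (g : Operad.Hom m.tree.operad
        (Operad.bv (linearOperad (SimplexCategory.mk n)) T.operad))
    (σ : m.tree ⟶ p.tree),
    yonedaEquiv.symm g ≫ stdTensorUnit n T = m.hom ∧ IsSplitEpi σ ∧
    (∀ x : m.tree.Edge, (g.color x).2 = Tree.edgeMap p.face (Tree.edgeMap σ x)) ∧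
    ∀ e, p.height.val e = {i | ∃ x : m.tree.Edge, Tree.edgeMap σ x = e ∧ (g.color x).1 = i}

end Dendroidal

/-!
# Monomorphisms into `Δ[n] ⊗ Ω[T]` and faces of `T` with height functions

In the Boardman–Vogt tensor product of the operad of `[n]` with `Ω(T)`, the interchange relation
allows one to move all operations of `[n]` in a term towards the variables. Every term therefore
has a normal form `BVTerm.normal`, consisting of one operation of `Ω(T)` whose inputs are raised by
unary operations of `[n]` (`BVTerm.exists_rel_normal`). Hence the tensor product has at most one
operation with given inputs and output (`Operad.isThin_bv`), and it has one if and only if `Ω(T)`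
has one and the height of the output is at most the heights of the inputs
(`Operad.nonempty_bv_op`). It follows that a dendrex of `Δ[n] ⊗ Ω[T]` of shape `R` is the same as a
morphism of trees `R ⟶ T` together with an order preserving map from the edges of `R` to
`{0, …, n}`, and that it is a monomorphism if and only if it is injective on edges
(`mono_dendrexMap_iff`).

Edges of `R` with comparable images in `T` are comparable (`Tree.above_or_above`), so the fibres of
a morphism of trees are linear, with unary vertices in between. Contracting the fibres gives the
factorization of a morphism into a degeneracy and a face (`Tree.image`); the heights that occur in
the fibres form a height function on the image. Conversely, given a face `S ⟶ T` and a height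
function `h` on `S`, each edge `e` of `S` is expanded into a linear tree with edges the elements of
`h e` (`HeightFunction.expansion`). The two constructions are inverse to each other up to
isomorphism because the factorization is unique (`Corresponds.unique_right`) and because a
degeneracy with heights that are injective on the fibres is determined by the sets of heights in
the fibres (`Tree.exists_iso_over`): each vertex of `S` has a unique preimage, from the highest edge
of one fibre to the lowest edges of others.

For the factorizations, every dendrex of `X ⊗ Ω[T]` comes from a simplex of `X`
(`exists_simplex_of_dendrex`), so its heights are vertices of that simplex. Conversely, heights that
avoid `I` are fixed by a retraction of `[n]` whose values avoid `I`, which makes the dendrex factor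
through the corresponding face of `Δ[n]` by naturality. A dendrex factors through
`Δ[n] ⊗ Ω[F]` if and only if the underlying morphism of trees factors through `F`, and this can be
tested after composition with a section of the degeneracy.
-/

namespace Dendroidal

/-! ### Thin operads and the Boardman–Vogt tensor product with a preorder -/

namespace Operad

/-- An operad is thin if it has at most one operation with given inputs and output. -/
def IsThin (P : Operad.{w}) : Prop :=
  ∀ {I : Type} [Finite I] (c : I → P.Color) (d : P.Color), Subsingleton (P.Op c d)

/-- A morphism into a thin operad is determined by its map on colours. -/
theorem Hom.ext_of_isThin {P : Operad.{w₁}} {Q : Operad.{w₂}} (hQ : Q.IsThin) {F G : Hom P Q}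
    (h : F.color = G.color) : F = G := by
  refine Hom.ext_op h fun I _ c d p => ?_
  obtain ⟨f, o, _, _, _⟩ := F
  obtain ⟨f', o', _, _, _⟩ := G
  obtain rfl : f = f' := h
  exact heq_of_eq ((hQ _ _).elim _ _)

/-- A map on colours that respects the existence of operations is a morphism, if the target is
thin. -/
noncomputable def Hom.ofIsThin {P : Operad.{w₁}} {Q : Operad.{w₂}} (hQ : Q.IsThin)
    (f : P.Color → Q.Color)
    (hf : ∀ {I : Type} [Finite I] {c : I → P.Color} {d : P.Color}, P.Op c d →
      Nonempty (Q.Op (fun i => f (c i)) (f d))) : Hom P Q where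
  color := f
  op p := (hf p).some
  op_one _ := (hQ _ _).elim _ _
  op_reindex _ _ _ _ := (hQ _ _).elim _ _
  op_comp _ _ := (hQ _ _).elim _ _

namespace BVTerm

instance finite_pos {P : Operad.{w₁}} {Q : Operad.{w₂}} {I : Type} {c : I → P.Color × Q.Color}
    {d : P.Color × Q.Color} (t : BVTerm P Q c d) : Finite t.Pos := by
  induction t with
  | var i => exact inferInstanceAs (Finite Unit)
  | @left J _ _ _ b p t ih => exact inferInstanceAs (Finite (Σ j, (t j).Pos))
  | @right J _ _ _ b p t ih => exact inferInstanceAs (Finite (Σ j, (t j).Pos))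

variable {X : Type} [Preorder X] {Q : Operad.{0}} {I : Type}
  {c : I → (ofPreorder X).Color × Q.Color} {d : (ofPreorder X).Color × Q.Color}

/-- The term that applies an operation of `Q` to variables, each of which is moved by a unary
operation of the preorder first. -/
def normal {J : Type} [Finite J] (l : J → I) (q : Q.Op (fun j => (c (l j)).2) d.2)
    (p : ∀ j, (ofPreorder X).Op (fun _ : Unit => (c (l j)).1) d.1) :
    BVTerm (ofPreorder X) Q c d :=
  right d.1 q fun j => left (c (l j)).2 (p j) fun _ => var (c := c) (l j)

theorem exists_rel_normal_of_equiv {J K : Type} [Finite J] [Finite K] (τ : K ≃ J) {l : J → I}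
    {m : K → I} (hm : m = fun k => l (τ k)) (q : Q.Op (fun j => (c (l j)).2) d.2)
    (p : ∀ j, (ofPreorder X).Op (fun _ : Unit => (c (l j)).1) d.1) :
    ∃ (q' : Q.Op (fun k => (c (m k)).2) d.2)
      (p' : ∀ k, (ofPreorder X).Op (fun _ : Unit => (c (m k)).1) d.1),
      Rel (ofPreorder X) Q (normal l q p) (normal m q' p') := by
  subst hm
  exact ⟨_, fun k => p (τ k), (Rel.right_reindex τ d.1 q
    fun j => left (c (l j)).2 (p j) fun _ => var (c := c) (l j)).symm⟩

/-- By the interchange relation the unary operations of the preorder can be moved towards the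
variables, past all operations of `Q`, and then be composed. -/
theorem exists_rel_normal (t : BVTerm (ofPreorder X) Q c d) :
    ∃ (q : Q.Op (fun j => (c (t.label j)).2) d.2)
      (p : ∀ j, (ofPreorder X).Op (fun _ : Unit => (c (t.label j)).1) d.1),
      Rel (ofPreorder X) Q t (normal t.label q p) := by
  induction t with
  | var i =>
    refine ⟨Q.one (c i).2, fun _ => (ofPreorder X).one (c i).1, ?_⟩
    exact ((Rel.right_one (c i).1 (c i).2 _).trans
      (Rel.left_one (c i).1 (c i).2 fun _ => var (c := c) i)).symm
  | @left J _ a a' b p t ih =>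
    obtain ⟨j, hj, hle⟩ := p.down
    choose q h r using ih
    -- The operation `p` has a single input `j`, so `J` can be replaced by `Unit`; then interchange
    -- applies, as its second operation may not depend on the input of the first one.
    let σ : Unit ≃ J := ⟨fun _ => j, fun _ => (), fun _ => rfl, fun k => (hj k).symm⟩
    let τ : (left b p t).Pos ≃ (t j).Pos :=
      { toFun := fun x => hj x.1 ▸ x.2
        invFun := fun x => ⟨j, x⟩
        left_inv := by rintro ⟨k, x⟩; obtain rfl := hj k; rfl
        right_inv := fun x => rfl }
    have hτ : (left b p t).label = fun x => (t j).label (τ x) := by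
      funext ⟨k, x⟩; obtain rfl := hj k; rfl
    let p₁ : (ofPreorder X).Op (fun _ : Unit => a j) a' := (ofPreorder X).reindex σ p
    have e₁ : Rel (ofPreorder X) Q (left b p t)
        (normal (d := (a', b)) (t j).label (q j)
          fun x => ⟨⟨(), fun _ => rfl, le_trans hle (h j x).down.choose_spec.2⟩⟩) := by
      refine (Rel.left_reindex σ b p t).symm.trans ?_
      refine (Rel.left_congr b p₁ (fun _ => r j)).trans ?_
      refine (Rel.interchange (J := Unit) p₁ (q j) (fun _ x =>
        left (c ((t j).label x)).2 (h j x) fun _ => var (c := c) ((t j).label x))).trans ?_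
      refine Rel.right_congr a' (q j) fun x => ?_
      refine (Rel.left_comp (J := Unit) (K := fun _ => Unit) (c ((t j).label x)).2 p₁
        (fun _ => h j x) (fun _ _ => var (c := c) ((t j).label x))).symm.trans ?_
      exact (Rel.left_reindex (Equiv.punitProd Unit |>.symm.trans
        (Equiv.sigmaEquivProd Unit Unit).symm) (c ((t j).label x)).2 _
        (fun _ => var (c := c) ((t j).label x))).symm
    obtain ⟨q', p', e₂⟩ := exists_rel_normal_of_equiv (d := (a', b)) τ hτ (q j) _
    exact ⟨q', p', e₁.trans e₂⟩
  | @right J _ b b' a q t ih =>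
    choose q' h r using ih
    refine ⟨Q.comp q q', fun x => h x.1 x.2, ?_⟩
    refine (Rel.right_congr a q r).trans ?_
    exact (Rel.right_comp a q q' (fun j k =>
      left (c ((t j).label k)).2 (h j k) fun _ => var (c := c) ((t j).label k))).symm

/-- A linear term is equivalent to a normal one in which the variables are ordered as given. -/
theorem Linear.exists_rel_normal [Finite I] {t : BVTerm (ofPreorder X) Q c d} (ht : t.Linear) :
    ∃ (q : Q.Op (fun i => (c i).2) d.2)
      (p : ∀ i, (ofPreorder X).Op (fun _ : Unit => (c i).1) d.1),
      Rel (ofPreorder X) Q t (normal id q p) := by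
  obtain ⟨q, p, h⟩ := BVTerm.exists_rel_normal t
  let e : t.Pos ≃ I := Equiv.ofBijective _ ht
  obtain ⟨q', p', h'⟩ := exists_rel_normal_of_equiv (m := id) e.symm
    (funext fun i => (e.apply_symm_apply i).symm) q p
  exact ⟨q', p', h.trans h'⟩

theorem linear_normal [Finite I] (q : Q.Op (fun i => (c i).2) d.2)
    (p : ∀ i, (ofPreorder X).Op (fun _ : Unit => (c i).1) d.1) :
    (normal (c := c) (d := d) id q p).Linear := by
  constructor
  · rintro ⟨i, ⟨⟩, ⟨⟩⟩ ⟨i', ⟨⟩, ⟨⟩⟩ h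
    obtain rfl : i = i' := h
    rfl
  · exact fun i => ⟨⟨i, (), ()⟩, rfl⟩

end BVTerm

theorem isThin_ofPreorder (X : Type) [Preorder X] : (ofPreorder X).IsThin :=
  fun _ _ => inferInstanceAs (Subsingleton (PLift _))

variable {X : Type} [Preorder X] {Q : Operad.{0}}

theorem isThin_bv (hQ : Q.IsThin) : (bv (ofPreorder X) Q).IsThin := by
  refine fun {I} _ c d => ⟨fun s t => ?_⟩
  obtain ⟨s, rfl⟩ := Quotient.exists_rep s
  obtain ⟨t, rfl⟩ := Quotient.exists_rep t
  obtain ⟨q, p, h⟩ := s.2.exists_rel_normal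
  obtain ⟨q', p', h'⟩ := t.2.exists_rel_normal
  obtain rfl : q = q' := (hQ _ _).elim _ _
  obtain rfl : p = p' := funext fun i => (isThin_ofPreorder X _ _).elim _ _
  exact Quotient.sound (h.trans h'.symm)

/-- The operations of the tensor product of a preorder and an operad `Q` are those of `Q`, with
a lower bound of the given heights of the inputs as height of the output. -/
theorem nonempty_bv_op {I : Type} [Finite I] (c : I → X × Q.Color) (d : X × Q.Color) :
    Nonempty ((bv (ofPreorder X) Q).Op c d) ↔
      Nonempty (Q.Op (fun i => (c i).2) d.2) ∧ ∀ i, d.1 ≤ (c i).1 := by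
  constructor
  · rintro ⟨t⟩
    obtain ⟨t, rfl⟩ := Quotient.exists_rep t
    obtain ⟨q, p, h⟩ := t.2.exists_rel_normal
    exact ⟨⟨q⟩, fun i => (p i).down.choose_spec.2⟩
  · rintro ⟨⟨q⟩, h⟩
    exact ⟨Quotient.mk _ ⟨_, BVTerm.linear_normal q fun i => ⟨⟨(), fun _ => rfl, h i⟩⟩⟩⟩

end Operad

theorem Tree.isThin_operad (T : Tree) : T.operad.IsThin :=
  fun _ _ => inferInstanceAs (Subsingleton (PLift _))

namespace Tree

/-! ### Morphisms of trees on edges -/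

variable {R S T : Tree}

/-- The edge `y` lies on the path from `x` to the root; `x = y` is allowed. -/
abbrev Above (T : Tree) (x y : T.Edge) : Prop := Relation.ReflTransGen T.Parent x y

/-- The inputs of a vertex. -/
def inputs (T : Tree) (v : T.Vert) : Set T.Edge := {a | T.target a = some v}

theorem Above.antisymm {x y : T.Edge} (h : T.Above x y) (h' : T.Above y x) : x = y := by
  rcases Relation.reflTransGen_iff_eq_or_transGen.1 h with e | h
  · exact e.symm
  · exact (not_transGen_self x (h.trans_left h')).elim

theorem Above.total {x y z : T.Edge} (h : T.Above x y) (h' : T.Above x z) :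
    T.Above y z ∨ T.Above z y :=
  Relation.ReflTransGen.total_of_right_unique parent_rightUnique h h'

theorem parent_of_mem_inputs {v : T.Vert} {a : T.Edge} (h : a ∈ T.inputs v) :
    T.Parent a (T.out v) := ⟨v, h, rfl⟩

theorem eq_of_above_inputs {v : T.Vert} {a b x : T.Edge} (ha : a ∈ T.inputs v)
    (hb : b ∈ T.inputs v) (hxa : T.Above x a) (hxb : T.Above x b) : a = b := by
  have key : ∀ {a b : T.Edge}, a ∈ T.inputs v → b ∈ T.inputs v → T.Above a b → a = b := by
    intro a b ha hb h
    rcases Relation.ReflTransGen.cases_head h with h | ⟨d, hd, hdb⟩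
    · exact h
    · obtain rfl := parent_rightUnique hd (parent_of_mem_inputs ha)
      exact (not_transGen_self _ (Relation.TransGen.head' (parent_of_mem_inputs hb) hdb)).elim
  rcases hxa.total hxb with h | h
  · exact key ha hb h
  · exact (key hb ha h).symm

/-- An edge properly above the output of a vertex lies above one of the inputs. -/
theorem exists_input_of_above {v : T.Vert} {x : T.Edge} (h : T.Above x (T.out v))
    (hne : x ≠ T.out v) : ∃ a ∈ T.inputs v, T.Above x a := by
  rcases Relation.ReflTransGen.cases_tail h with e | ⟨a, hxa, w, ha, hw⟩
  · exact (hne e.symm).elim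
  · exact ⟨a, by rw [← T.out_injective hw]; exact ha, hxa⟩

/-- Two edges are comparable, or their paths to the root meet at a vertex. -/
theorem above_or_above_or_join (x y : T.Edge) :
    T.Above x y ∨ T.Above y x ∨
      ∃ v, ∃ a ∈ T.inputs v, ∃ b ∈ T.inputs v, a ≠ b ∧ T.Above x a ∧ T.Above y b := by
  induction T.to_root y using Relation.ReflTransGen.head_induction_on with
  | refl => exact .inl (T.to_root x)
  | @head y z hyz _ ih =>
    rcases ih with h | h | ⟨v, a, ha, b, hb, hab, hx, hy⟩
    · obtain ⟨v, hv, rfl⟩ := hyz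
      by_cases e : x = T.out v
      · exact .inr (.inl (e ▸ .single ⟨v, hv, rfl⟩))
      · obtain ⟨a, ha, hxa⟩ := exists_input_of_above h e
        by_cases hay : a = y
        · exact .inl (hay ▸ hxa)
        · exact .inr (.inr ⟨v, a, ha, y, hv, hay, hxa, .refl⟩)
    · exact .inr (.inl (.head hyz h))
    · exact .inr (.inr ⟨v, a, ha, b, hb, hab, hx, .head hyz hy⟩)

theorem isSubtree_inputs (v : T.Vert) : T.IsSubtree (T.inputs v) (T.out v) := by
  have h := IsSubtree.vertex v (fun a => {a.1}) fun a => IsSubtree.edge a.1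
  have : (⋃ a : {a : T.Edge // T.target a = some v}, ({a.1} : Set T.Edge)) = T.inputs v := by
    ext x
    simp [inputs]
  rwa [this] at h

theorem IsSubtree.eq_singleton {L : Set T.Edge} {e : T.Edge} (h : T.IsSubtree L e) (he : e ∈ L) :
    L = {e} :=
  Set.eq_singleton_iff_unique_mem.2 ⟨he, fun _ hx => h.antichain hx he (h.le hx)⟩

theorem IsSubtree.trans_singleton {L : Set T.Edge} {e d : T.Edge} (h : T.IsSubtree {e} d)
    (h' : T.IsSubtree L e) : T.IsSubtree L d := by
  simpa using h.graft (fun _ => L) (by rintro _ rfl; exact h')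

/-- A subtree that is not a single edge has a lowest vertex, and it consists of that vertex only
if every input of the vertex lies above a leaf of the subtree. -/
theorem IsSubtree.exists_vertex {L : Set T.Edge} {e : T.Edge} (h : T.IsSubtree L e)
    (he : e ∉ L) : ∃ v, T.out v = e ∧
      ((∀ a ∈ T.inputs v, ∃ l ∈ L, T.Above a l) → L = T.inputs v) := by
  have h₀ := h
  cases h with
  | edge => exact (he rfl).elim
  | vertex v L h =>
    refine ⟨v, rfl, fun hL => ?_⟩
    have sub : T.inputs v ⊆ ⋃ a, L a := by
      intro a ha
      obtain ⟨l, hl, hal⟩ := hL a ha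
      obtain ⟨b, hb⟩ := Set.mem_iUnion.1 hl
      obtain rfl : a = b.1 := eq_of_above_inputs ha b.2 .refl (hal.trans ((h b).le hb))
      obtain rfl := Above.antisymm hal ((h b).le hb)
      exact hl
    refine Set.Subset.antisymm (fun l hl => ?_) sub
    obtain ⟨b, hb⟩ := Set.mem_iUnion.1 hl
    rw [h₀.antichain hl (sub b.2) ((h b).le hb)]
    exact b.2

theorem edgeMap_comp (f : R ⟶ S) (g : S ⟶ T) (x : R.Edge) :
    edgeMap (f ≫ g) x = edgeMap g (edgeMap f x) := rfl

theorem hom_ext {f g : S ⟶ T} (h : ∀ x, edgeMap f x = edgeMap g x) : f = g :=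
  Operad.Hom.ext_of_isThin T.isThin_operad (funext h)

instance (T : Tree) : Finite T.Edge := T.finite_edge

/-- A morphism of trees maps a subtree to a subtree. -/
theorem IsSubtree.image (f : S ⟶ T) {L : Set S.Edge} {e : S.Edge} (h : S.IsSubtree L e) :
    Set.InjOn (edgeMap f) L ∧ T.IsSubtree (edgeMap f '' L) (edgeMap f e) := by
  have p : S.operad.Op (I := L) (fun x => x.1) e :=
    ⟨Subtype.val_injective, by rw [Subtype.range_coe]; exact h⟩
  have q := (Operad.Hom.op f p).down
  refine ⟨Set.injOn_iff_injective.2 q.1, ?_⟩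
  have := q.2
  rwa [Set.image_eq_range]

/-- The operad of a tree is free on the vertices, so a morphism is given by its values on
vertices. -/
noncomputable def homMk (f : S.Edge → T.Edge) (inj : ∀ v, Set.InjOn f (S.inputs v))
    (sub : ∀ v, T.IsSubtree (f '' S.inputs v) (f (S.out v))) : S ⟶ T :=
  have key : ∀ {L : Set S.Edge} {e : S.Edge}, S.IsSubtree L e →
      Set.InjOn f L ∧ T.IsSubtree (f '' L) (f e) := by
    intro L e h
    induction h with
    | edge e => simpa using IsSubtree.edge (f e)
    | vertex v L h ih =>
      have := isSubtree_comp (I := {a // S.target a = some v}) (J := fun a => L a)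
        (c := fun a => f a.1) (d := f (S.out v)) (b := fun (a : {a // S.target a = some v}) (x : L a) => f x.1)
        (Set.injOn_iff_injective.1 (inj v))
        (by have := sub v; rwa [Set.image_eq_range] at this)
        (fun a => Set.injOn_iff_injective.1 (ih a).1)
        (fun a => by have := (ih a).2; rwa [Set.image_eq_range] at this)
      constructor
      · intro x hx y hy hxy
        obtain ⟨a, ha⟩ := Set.mem_iUnion.1 hx
        obtain ⟨b, hb⟩ := Set.mem_iUnion.1 hy
        have := this.1 (a₁ := ⟨a, ⟨x, ha⟩⟩) (a₂ := ⟨b, ⟨y, hb⟩⟩) hxy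
        cases this
        rfl
      · have e : f '' (⋃ a, L a) = Set.range (fun x : Σ a, L a => f x.2.1) := by
          ext y
          simp only [Set.mem_image, Set.mem_iUnion, Set.mem_range, Sigma.exists, Subtype.exists,
            exists_prop]
          constructor
          · rintro ⟨x, ⟨a, ha, hx⟩, rfl⟩
            exact ⟨a, ha, x, hx, rfl⟩
          · rintro ⟨a, ha, x, hx, rfl⟩
            exact ⟨x, ⟨a, ha, hx⟩, rfl⟩
        rw [e]
        exact this.2
  Operad.Hom.ofIsThin T.isThin_operad f fun p => by
    obtain ⟨h₁, h₂⟩ := key p.down.2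
    refine ⟨⟨fun i j h => p.down.1 (h₁ ⟨i, rfl⟩ ⟨j, rfl⟩ h), ?_⟩⟩
    exact (Set.range_comp f _).symm ▸ h₂

theorem Above.map (f : S ⟶ T) {x y : S.Edge} (h : S.Above x y) :
    T.Above (edgeMap f x) (edgeMap f y) := by
  induction h with
  | refl => exact .refl
  | tail _ h ih =>
    obtain ⟨v, hv, rfl⟩ := h
    exact ih.trans (((isSubtree_inputs v).image f).2.le ⟨_, hv, rfl⟩)

/-- Edges with comparable images are comparable: if the paths to the root of two edges meet at a
vertex, then their images lie above two different leaves of a subtree. -/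
theorem above_or_above (f : S ⟶ T) {x y : S.Edge} (h : T.Above (edgeMap f x) (edgeMap f y)) :
    S.Above x y ∨ S.Above y x := by
  rcases above_or_above_or_join x y with h' | h' | ⟨v, a, ha, b, hb, hab, hx, hy⟩
  · exact .inl h'
  · exact .inr h'
  · have hv := (isSubtree_inputs v).image f
    refine (hab ?_).elim
    rcases (hx.map f).total (h.trans (hy.map f)) with h' | h'
    · exact hv.1 ha hb (hv.2.antichain ⟨a, ha, rfl⟩ ⟨b, hb, rfl⟩ h')
    · exact (hv.1 hb ha (hv.2.antichain ⟨b, hb, rfl⟩ ⟨a, ha, rfl⟩ h')).symm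

/-- An edge whose image lies properly above the image of another one lies above it. -/
theorem above_of_above_of_ne (f : S ⟶ T) {x y : S.Edge}
    (h : T.Above (edgeMap f x) (edgeMap f y)) (hne : edgeMap f x ≠ edgeMap f y) :
    S.Above x y := by
  rcases above_or_above f h with h' | h'
  · exact h'
  · exact (hne (h.antisymm (h'.map f))).elim

/-- A vertex is unary if one of its inputs has the same image as its output. -/
theorem inputs_eq_singleton (f : S ⟶ T) {v : S.Vert} {a : S.Edge} (ha : a ∈ S.inputs v)
    (h : edgeMap f a = edgeMap f (S.out v)) : S.inputs v = {a} := by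
  have hv := (isSubtree_inputs v).image f
  have := hv.2.eq_singleton ⟨a, ha, h⟩
  refine Set.eq_singleton_iff_unique_mem.2 ⟨ha, fun b hb => hv.1 hb ha ?_⟩
  have hb' : edgeMap f b ∈ edgeMap f '' S.inputs v := ⟨b, hb, rfl⟩
  rw [this] at hb'
  exact hb'.trans h.symm

/-- The fibres of a morphism are linear. -/
theorem isSubtree_singleton (f : S ⟶ T) {x y : S.Edge} (h : S.Above x y)
    (hxy : edgeMap f x = edgeMap f y) : S.IsSubtree {x} y := by
  induction h using Relation.ReflTransGen.head_induction_on with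
  | refl => exact .edge y
  | @head x z hxz hzy ih =>
    obtain ⟨v, hv, rfl⟩ := hxz
    have e : edgeMap f x = edgeMap f (S.out v) :=
      (Above.map f (.single ⟨v, hv, rfl⟩)).antisymm (hxy ▸ Above.map f hzy)
    refine (ih (e.symm.trans hxy)).trans_singleton ?_
    rw [← inputs_eq_singleton f hv e]
    exact isSubtree_inputs v

/-- The tree `η` with one edge and no vertices; morphisms from it represent the edges of a tree. -/
def eta : Tree where
  Edge := Unit
  Vert := Empty
  finite_edge := inferInstance
  root := ()
  out := Empty.elim
  out_injective v := v.elim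
  target _ := none
  target_eq_none := fun _ => by simp
  to_root _ := .refl

/-- The inclusion of an edge. -/
noncomputable def ofEdge (x : T.Edge) : eta ⟶ T :=
  homMk (fun _ => x) (fun v => v.elim) (fun v => v.elim)

theorem edgeMap_injective (u : S ⟶ T) [Mono u] : Function.Injective (edgeMap u) := by
  intro x y h
  have : ofEdge x ≫ u = ofEdge y ≫ u := hom_ext fun _ => h
  exact congrArg (fun f => edgeMap f ()) ((cancel_mono u).1 this)

theorem mono_of_injective {u : S ⟶ T} (h : Function.Injective (edgeMap u)) : Mono u :=
  ⟨fun _ _ e => hom_ext fun x => h (congrArg (fun k => edgeMap k x) e)⟩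

/-! ### Factorization of a morphism of trees into a degeneracy and a face -/

/-- The edge `x` is the lowest edge in its fibre. -/
def IsBottom (f : S ⟶ T) (x : S.Edge) : Prop :=
  ∀ y, S.Parent x y → edgeMap f y ≠ edgeMap f x

theorem exists_isBottom (f : S ⟶ T) (x : S.Edge) :
    ∃ b, IsBottom f b ∧ edgeMap f b = edgeMap f x ∧ S.Above x b := by
  induction S.to_root x using Relation.ReflTransGen.head_induction_on with
  | refl =>
    refine ⟨S.root, ?_, rfl, .refl⟩
    rintro y ⟨v, hv, -⟩
    rw [(S.target_eq_none _).2 rfl] at hv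
    cases hv
  | @head x y hxy _ ih =>
    by_cases h : edgeMap f y = edgeMap f x
    · obtain ⟨b, hb, e, hyb⟩ := ih
      exact ⟨b, hb, e.trans h, .head hxy hyb⟩
    · refine ⟨x, fun z hz => ?_, rfl, .refl⟩
      rwa [parent_rightUnique hz hxy]

theorem IsBottom.above {f : S ⟶ T} {b x : S.Edge} (hb : IsBottom f b)
    (h : edgeMap f b = edgeMap f x) : S.Above x b := by
  rcases above_or_above (x := x) (y := b) f (h ▸ .refl) with h' | h'
  · exact h'
  · rcases Relation.ReflTransGen.cases_head h' with rfl | ⟨z, hz, hzx⟩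
    · exact .refl
    · exact (hb z hz ((h ▸ Above.map f hzx : T.Above _ _).antisymm (Above.map f (.single hz)))).elim

theorem IsBottom.eq {f : S ⟶ T} {b b' : S.Edge} (hb : IsBottom f b) (hb' : IsBottom f b')
    (h : edgeMap f b = edgeMap f b') : b = b' :=
  (hb'.above h.symm).antisymm (hb.above h)

/-- The lowest edge with the same image as `x`. -/
noncomputable def bottom (f : S ⟶ T) (x : S.Edge) : {x // IsBottom f x} :=
  ⟨(exists_isBottom f x).choose, (exists_isBottom f x).choose_spec.1⟩

theorem edgeMap_bottom (f : S ⟶ T) (x : S.Edge) : edgeMap f (bottom f x) = edgeMap f x :=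
  (exists_isBottom f x).choose_spec.2.1

theorem bottom_eq {f : S ⟶ T} {b : {x // IsBottom f x}} {x : S.Edge}
    (h : edgeMap f b = edgeMap f x) : bottom f x = b :=
  Subtype.ext ((bottom f x).2.eq b.2 ((edgeMap_bottom f x).trans h.symm))

/-- No input of the vertex `v` has the same image as its output. -/
def IsNondegenerate (f : S ⟶ T) (v : S.Vert) : Prop :=
  ∀ a ∈ S.inputs v, edgeMap f a ≠ edgeMap f (S.out v)

theorem IsBottom.isNondegenerate {f : S ⟶ T} {b : S.Edge} (hb : IsBottom f b) {v : S.Vert}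
    (h : b ∈ S.inputs v) : IsNondegenerate f v := by
  intro a ha e
  have h' := inputs_eq_singleton f ha e
  rw [h'] at h
  obtain rfl : b = a := h
  exact hb _ (parent_of_mem_inputs ha) e.symm

theorem IsNondegenerate.isBottom {f : S ⟶ T} {v : S.Vert} (hv : IsNondegenerate f v) {a : S.Edge}
    (h : a ∈ S.inputs v) : IsBottom f a := by
  intro y hy
  obtain rfl := parent_rightUnique hy (parent_of_mem_inputs h)
  exact (hv a h).symm

/-- The output of a nondegenerate vertex is the highest edge in its fibre. -/
theorem IsNondegenerate.above {f : S ⟶ T} {v : S.Vert} (hv : IsNondegenerate f v) {x : S.Edge}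
    (h : edgeMap f x = edgeMap f (S.out v)) : S.Above (S.out v) x := by
  rcases above_or_above (x := x) (y := S.out v) f (h ▸ .refl) with h' | h'
  · by_cases e : x = S.out v
    · exact e ▸ .refl
    · obtain ⟨a, ha, hxa⟩ := exists_input_of_above h' e
      exact (hv a ha ((Above.map f (.single (parent_of_mem_inputs ha))).antisymm
        (h ▸ hxa.map f))).elim
  · exact h'

open Classical in
/-- The vertex below an edge of the image. -/
noncomputable def imageTarget (f : S ⟶ T) (e : {x // IsBottom f x}) :
    Option {v // IsNondegenerate f v} :=
  if h : ∃ v : {v // IsNondegenerate f v}, S.target e = some v.1 then some h.choose else none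

theorem imageTarget_eq_some {f : S ⟶ T} {e : {x // IsBottom f x}}
    {v : {v // IsNondegenerate f v}} : imageTarget f e = some v ↔ S.target e = some v.1 := by
  unfold imageTarget
  split
  · next h =>
    refine Option.some_inj.trans (Subtype.ext_iff.trans ?_)
    exact ⟨fun e => e ▸ h.choose_spec, fun e => Option.some.inj (h.choose_spec.symm.trans e)⟩
  · next h => exact ⟨nofun, fun h' => (h ⟨v, h'⟩).elim⟩

theorem imageTarget_eq_none {f : S ⟶ T} {e : {x // IsBottom f x}} :
    imageTarget f e = none ↔ S.target e = none := by
  rw [Option.eq_none_iff_forall_ne_some, Option.eq_none_iff_forall_ne_some]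
  exact ⟨fun h v hv => h ⟨v, e.2.isNondegenerate hv⟩ (imageTarget_eq_some.2 hv),
    fun h v hv => h v.1 (imageTarget_eq_some.1 hv)⟩

/-- The image of a morphism of trees: each fibre is contracted to its lowest edge. The edges are
represented by the lowest edges of the fibres; the vertices are the nondegenerate ones. -/
noncomputable def image (f : S ⟶ T) : Tree where
  Edge := {x // IsBottom f x}
  Vert := {v // IsNondegenerate f v}
  finite_edge := inferInstance
  root := bottom f S.root
  out v := bottom f (S.out v)
  out_injective v w h := by
    have e : edgeMap f (S.out v) = edgeMap f (S.out w) :=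
      (edgeMap_bottom f _).symm.trans ((congrArg (fun b => edgeMap f b.1) h).trans
        (edgeMap_bottom f _))
    exact Subtype.ext (S.out_injective ((w.2.above e).antisymm (v.2.above e.symm)).symm)
  target := imageTarget f
  target_eq_none e := by
    have hr : (bottom f S.root).1 = S.root :=
      Above.antisymm (S.to_root _) ((bottom f S.root).2.above (edgeMap_bottom f _))
    rw [imageTarget_eq_none, S.target_eq_none, Subtype.ext_iff, hr]
  to_root e := by
    have key : ∀ x : S.Edge, Relation.ReflTransGen (fun e d : {x // IsBottom f x} =>
        ∃ v, imageTarget f e = some v ∧ bottom f (S.out v.1) = d)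
        (bottom f x) (bottom f S.root) := by
      intro x
      induction S.to_root x using Relation.ReflTransGen.head_induction_on with
      | refl => exact .refl
      | @head x y hxy _ ih =>
        by_cases h : edgeMap f x = edgeMap f y
        · rw [bottom_eq ((edgeMap_bottom f y).trans h.symm)]
          exact ih
        · obtain ⟨v, hv, rfl⟩ := hxy
          have hb : IsBottom f x := by
            intro z hz
            obtain rfl := parent_rightUnique hz ⟨v, hv, rfl⟩
            exact Ne.symm h
          rw [bottom_eq (b := ⟨x, hb⟩) rfl]
          exact .head ⟨⟨v, hb.isNondegenerate hv⟩, imageTarget_eq_some.2 hv, rfl⟩ ih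
    have := key e
    rwa [bottom_eq rfl] at this

/-- The map on edges of the degeneracy onto the image. -/
noncomputable def toImageEdge (f : S ⟶ T) (x : S.Edge) : (image f).Edge := bottom f x

/-- The edge that represents an edge of the image. -/
def ofImageEdge (f : S ⟶ T) (x : (image f).Edge) : S.Edge := Subtype.val x

theorem toImageEdge_ofImageEdge (f : S ⟶ T) (x : (image f).Edge) :
    toImageEdge f (ofImageEdge f x) = x := bottom_eq rfl

theorem edgeMap_ofImageEdge_toImageEdge (f : S ⟶ T) (x : S.Edge) :
    edgeMap f (ofImageEdge f (toImageEdge f x)) = edgeMap f x := edgeMap_bottom f x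

theorem ofImageEdge_injective (f : S ⟶ T) : Function.Injective (ofImageEdge f) :=
  Subtype.val_injective

theorem isBottom_ofImageEdge (f : S ⟶ T) (x : (image f).Edge) : IsBottom f (ofImageEdge f x) :=
  Subtype.property x

theorem ofImageEdge_toImageEdge {f : S ⟶ T} {x : S.Edge} (h : IsBottom f x) :
    ofImageEdge f (toImageEdge f x) = x :=
  congrArg Subtype.val (bottom_eq (b := ⟨x, h⟩) rfl)

theorem mem_inputs_image {f : S ⟶ T} {v : (image f).Vert} {a : (image f).Edge} :
    a ∈ (image f).inputs v ↔ ofImageEdge f a ∈ S.inputs v.1 := imageTarget_eq_some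

/-- The degeneracy onto the image. -/
noncomputable def toImage (f : S ⟶ T) : S ⟶ image f :=
  homMk (toImageEdge f)
    (fun v x hx y hy h => by
      refine ((isSubtree_inputs v).image f).1 hx hy ?_
      rw [← edgeMap_ofImageEdge_toImageEdge, h, edgeMap_ofImageEdge_toImageEdge])
    (fun v => by
      by_cases hv : IsNondegenerate f v
      · have h := isSubtree_inputs (T := image f) ⟨v, hv⟩
        have e : toImageEdge f '' S.inputs v = (image f).inputs ⟨v, hv⟩ := by
          ext a
          refine Iff.trans ?_ mem_inputs_image.symm
          constructor
          · rintro ⟨x, hx, rfl⟩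
            rw [ofImageEdge_toImageEdge (hv.isBottom hx)]
            exact hx
          · exact fun h => ⟨ofImageEdge f a, h, toImageEdge_ofImageEdge f a⟩
        rw [e]
        exact h
      · simp only [IsNondegenerate, not_forall, not_not] at hv
        obtain ⟨a, ha, h⟩ := hv
        have e : toImageEdge f a = toImageEdge f (S.out v) :=
          ofImageEdge_injective f ((isBottom_ofImageEdge f _).eq (isBottom_ofImageEdge f _)
            (by rw [edgeMap_ofImageEdge_toImageEdge, edgeMap_ofImageEdge_toImageEdge, h]))
        rw [inputs_eq_singleton f ha h, Set.image_singleton, e]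
        exact .edge _)

/-- The section of the degeneracy onto the image given by the lowest edges of the fibres. -/
noncomputable def imageSection (f : S ⟶ T) : image f ⟶ S :=
  homMk (ofImageEdge f) (fun _ => (ofImageEdge_injective f).injOn) (fun v => by
    have e : ofImageEdge f '' (image f).inputs v = S.inputs v.1 := by
      ext a
      refine ⟨fun ⟨x, hx, h⟩ => h ▸ mem_inputs_image.1 hx, fun h => ?_⟩
      have ha := ofImageEdge_toImageEdge (v.2.isBottom h)
      exact ⟨toImageEdge f a, mem_inputs_image.2 (by rw [ha]; exact h), ha⟩
    rw [e]
    have h := edgeMap_bottom f (S.out v.1)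
    exact (isSubtree_singleton f ((bottom f (S.out v.1)).2.above h) h.symm).trans_singleton
      (isSubtree_inputs v.1))

theorem imageSection_toImage (f : S ⟶ T) : imageSection f ≫ toImage f = 𝟙 _ :=
  hom_ext fun x => toImageEdge_ofImageEdge f x

instance (f : S ⟶ T) : IsSplitEpi (toImage f) := ⟨⟨⟨_, imageSection_toImage f⟩⟩⟩

theorem toImage_fac (f : S ⟶ T) : toImage f ≫ imageSection f ≫ f = f :=
  hom_ext fun x => edgeMap_bottom f x

instance (f : S ⟶ T) : Mono (imageSection f ≫ f) :=
  mono_of_injective fun a b h => Subtype.ext (a.2.eq b.2 h)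

end Tree

/-! ### The degeneracy with given heights of the edges -/

namespace HeightFunction

variable {n : ℕ} {S : Tree} (h : HeightFunction n S)

theorem exists_isLeast (e : S.Edge) : ∃ i, IsLeast (h.val e) i := by
  obtain ⟨i, hi, h'⟩ := Set.exists_min_image _ id (h.val e).toFinite (h.nonempty e)
  exact ⟨i, hi, h'⟩

theorem exists_isGreatest (e : S.Edge) : ∃ i, IsGreatest (h.val e) i := by
  obtain ⟨i, hi, h'⟩ := Set.exists_max_image _ id (h.val e).toFinite (h.nonempty e)
  exact ⟨i, hi, h'⟩

/-- The smallest height of an edge. -/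
noncomputable def low (e : S.Edge) : Fin (n + 1) := (h.exists_isLeast e).choose

/-- The greatest height of an edge. -/
noncomputable def high (e : S.Edge) : Fin (n + 1) := (h.exists_isGreatest e).choose

theorem isLeast_low (e : S.Edge) : IsLeast (h.val e) (h.low e) := (h.exists_isLeast e).choose_spec

theorem isGreatest_high (e : S.Edge) : IsGreatest (h.val e) (h.high e) :=
  (h.exists_isGreatest e).choose_spec

/-- An edge together with one of its heights. -/
abbrev Level : Type := {x : S.Edge × Fin (n + 1) // x.2 ∈ h.val x.1}

/-- An edge together with a height that is not the smallest one. -/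
abbrev UpperLevel : Type := {x : h.Level // x.1.2 ≠ h.low x.1.1}

/-- An edge with its smallest height. -/
noncomputable def lowest (e : S.Edge) : h.Level := ⟨(e, h.low e), (h.isLeast_low e).1⟩

/-- An edge with its greatest height. -/
noncomputable def highest (e : S.Edge) : h.Level := ⟨(e, h.high e), (h.isGreatest_high e).1⟩

theorem exists_isGreatest_lt (x : h.UpperLevel) :
    ∃ j, IsGreatest {j | j ∈ h.val x.1.1.1 ∧ j < x.1.1.2} j := by
  obtain ⟨i, hi, h'⟩ := Set.exists_max_image {j | j ∈ h.val x.1.1.1 ∧ j < x.1.1.2} id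
    (Set.toFinite _) ⟨h.low x.1.1.1, (h.isLeast_low _).1,
      lt_of_le_of_ne ((h.isLeast_low _).2 x.1.2) x.2.symm⟩
  exact ⟨i, hi, h'⟩

/-- The same edge with the next smaller height. -/
noncomputable def pred (x : h.UpperLevel) : h.Level :=
  ⟨(x.1.1.1, (h.exists_isGreatest_lt x).choose), (h.exists_isGreatest_lt x).choose_spec.1.1⟩

theorem pred_lt (x : h.UpperLevel) : (h.pred x).1.2 < x.1.1.2 :=
  (h.exists_isGreatest_lt x).choose_spec.1.2

theorem le_pred (x : h.UpperLevel) {j : Fin (n + 1)} (hj : j ∈ h.val x.1.1.1)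
    (hjx : j < x.1.1.2) : j ≤ (h.pred x).1.2 :=
  (h.exists_isGreatest_lt x).choose_spec.2 ⟨hj, hjx⟩

theorem pred_injective : Function.Injective h.pred := by
  rintro ⟨⟨⟨e, i⟩, hi⟩, hx⟩ ⟨⟨⟨e', i'⟩, hi'⟩, hx'⟩ hp
  obtain rfl : e = e' := congrArg (fun x => x.1.1) hp
  have hp' := congrArg (fun x => x.1.2) hp
  obtain h' | rfl | h' := lt_trichotomy i i'
  · have := h.le_pred ⟨⟨⟨e, i'⟩, hi'⟩, hx'⟩ hi h'
    exact ((hp' ▸ this).not_gt (h.pred_lt _)).elim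
  · rfl
  · have := h.le_pred ⟨⟨⟨e, i⟩, hi⟩, hx⟩ hi' h'
    exact ((hp' ▸ this).not_gt (h.pred_lt _)).elim

open Classical in
/-- The vertex below an edge with a height. -/
noncomputable def levelTarget (x : h.Level) : Option (S.Vert ⊕ h.UpperLevel) :=
  if hx : x.1.2 = h.low x.1.1 then (S.target x.1.1).map .inl else some (.inr ⟨x, hx⟩)

/-- The output of a vertex of the tree of edges with heights. -/
noncomputable def levelOut : S.Vert ⊕ h.UpperLevel → h.Level
  | .inl v => h.highest (S.out v)
  | .inr x => h.pred x

theorem levelTarget_eq_inl {x : h.Level} {v : S.Vert} :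
    h.levelTarget x = some (.inl v) ↔ x = h.lowest x.1.1 ∧ S.target x.1.1 = some v := by
  have : x = h.lowest x.1.1 ↔ x.1.2 = h.low x.1.1 := by
    rw [Subtype.ext_iff, Prod.ext_iff]
    exact ⟨And.right, fun h => ⟨rfl, h⟩⟩
  rw [this]
  unfold levelTarget
  split
  · next hx => simp [hx]
  · next hx => simp [hx]

theorem levelTarget_eq_inr {x : h.Level} {y : h.UpperLevel} :
    h.levelTarget x = some (.inr y) ↔ x = y.1 := by
  unfold levelTarget
  split
  · next hx =>
    constructor
    · simp
    · rintro rfl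
      exact (y.2 hx).elim
  · next hx => simp [Subtype.ext_iff]

theorem levelOut_injective : Function.Injective h.levelOut := by
  -- The predecessor of a height of an edge is not the greatest height of that edge.
  have key : ∀ v x, h.highest (S.out v) ≠ h.pred x := by
    intro v x e
    have h₁ : S.out v = x.1.1.1 := congrArg (fun x => x.1.1) e
    have h₂ : h.high (S.out v) = (h.pred x).1.2 := congrArg (fun x => x.1.2) e
    have h₃ := (h.isGreatest_high x.1.1.1).2 x.1.2
    rw [← h₁, h₂] at h₃
    exact h₃.not_gt (h.pred_lt x)
  rintro (v | x) (w | y) e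
  · exact congrArg _ (S.out_injective (congrArg (fun x => x.1.1) e))
  · exact (key _ _ e).elim
  · exact (key _ _ e.symm).elim
  · exact congrArg _ (h.pred_injective e)

theorem reflTransGen_lowest (e : S.Edge) (i : Fin (n + 1)) (hi : i ∈ h.val e) :
    Relation.ReflTransGen (fun x y => ∃ v, h.levelTarget x = some v ∧ h.levelOut v = y)
      ⟨(e, i), hi⟩ (h.lowest e) := by
  induction i using WellFoundedLT.induction with
  | ind i ih =>
    by_cases hx : i = h.low e
    · subst hx
      exact .refl
    · exact .head ⟨.inr ⟨⟨(e, i), hi⟩, hx⟩, h.levelTarget_eq_inr.2 rfl, rfl⟩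
        (ih _ (h.pred_lt ⟨⟨(e, i), hi⟩, hx⟩) (h.pred ⟨⟨(e, i), hi⟩, hx⟩).2)

/-- The tree in which each edge `e` of `S` is replaced by a linear tree with edges the elements
of `h e`. -/
noncomputable def expansion : Tree where
  Edge := h.Level
  Vert := S.Vert ⊕ h.UpperLevel
  finite_edge := inferInstance
  root := h.lowest S.root
  out := h.levelOut
  out_injective := h.levelOut_injective
  target := h.levelTarget
  target_eq_none x := by
    constructor
    · intro hx
      unfold levelTarget at hx
      split at hx
      · next hl =>
        have : x.1.1 = S.root := by simpa [S.target_eq_none] using hx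
        exact Subtype.ext (Prod.ext this (hl.trans (congrArg h.low this)))
      · cases hx
    · rintro rfl
      unfold levelTarget
      exact (dif_pos rfl).trans 
        (Option.map_eq_none_iff.2 ((S.target_eq_none S.root).2 rfl))
  to_root x := by
    obtain ⟨⟨e, i⟩, hi⟩ := x
    induction S.to_root e using Relation.ReflTransGen.head_induction_on generalizing i with
    | refl => exact h.reflTransGen_lowest _ _ _
    | @head e e' hee' _ ih =>
      obtain ⟨v, hv, rfl⟩ := hee'
      exact (h.reflTransGen_lowest _ _ _).trans
        (.head ⟨.inl v, h.levelTarget_eq_inl.2 ⟨rfl, hv⟩, rfl⟩ (ih _ _))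

/-- The edge of `S` that underlies an edge of the expansion. -/
def baseEdge (x : h.expansion.Edge) : S.Edge := x.1.1

/-- The height of an edge of the expansion. -/
def level (x : h.expansion.Edge) : Fin (n + 1) := x.1.2

theorem level_mem (x : h.expansion.Edge) : h.level x ∈ h.val (h.baseEdge x) := x.2

/-- The lowest edge of the expansion over an edge of `S`. -/
noncomputable def lowEdge (e : S.Edge) : h.expansion.Edge := h.lowest e

theorem baseEdge_lowEdge (e : S.Edge) : h.baseEdge (h.lowEdge e) = e := rfl

theorem edge_ext {x y : h.expansion.Edge} (hb : h.baseEdge x = h.baseEdge y)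
    (hl : h.level x = h.level y) : x = y := Subtype.ext (Prod.ext hb hl)

theorem inputs_inl (v : S.Vert) : h.expansion.inputs (.inl v) = h.lowEdge '' S.inputs v := by
  ext x
  refine (h.levelTarget_eq_inl (x := x)).trans ⟨fun hx => ⟨_, hx.2, hx.1.symm⟩, ?_⟩
  rintro ⟨e, he, rfl⟩
  exact ⟨rfl, he⟩

/-- An edge of the expansion that is not the lowest one over an edge of `S`. -/
def upperEdge (x : h.UpperLevel) : h.expansion.Edge := x.1

theorem inputs_inr (x : h.UpperLevel) : h.expansion.inputs (.inr x) = {h.upperEdge x} :=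
  Set.ext fun _ => h.levelTarget_eq_inr

theorem level_le_of_parent {x y : h.expansion.Edge} (hxy : h.expansion.Parent x y) :
    h.level y ≤ h.level x := by
  obtain ⟨v | z, hv, rfl⟩ := hxy
  · obtain ⟨-, hx⟩ := h.levelTarget_eq_inl.1 hv
    exact h.monotone (S.out v) x.1.1 (.single ⟨v, hx, rfl⟩) _ (h.isGreatest_high _).1 _ x.2
  · obtain rfl := h.levelTarget_eq_inr.1 hv
    exact (h.pred_lt z).le

/-- The degeneracy that contracts the linear trees in the expansion. -/
noncomputable def contract : h.expansion ⟶ S :=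
  Tree.homMk h.baseEdge
    (by
      rintro (v | x)
      · rw [inputs_inl]
        rintro _ ⟨e, -, rfl⟩ _ ⟨e', -, rfl⟩ hb
        exact congrArg h.lowEdge hb
      · rw [inputs_inr]
        exact Set.injOn_singleton _ _)
    (by
      rintro (v | x)
      · rw [inputs_inl, Set.image_image]
        simp only [baseEdge_lowEdge, Set.image_id']
        exact Tree.isSubtree_inputs v
      · rw [inputs_inr, Set.image_singleton]
        exact .edge x.1.1.1)

/-- The section of the degeneracy given by the smallest heights. -/
noncomputable def expansionSection : S ⟶ h.expansion :=
  Tree.homMk h.lowEdge (fun _ _ _ _ _ e => congrArg h.baseEdge e) fun v => by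
    rw [← inputs_inl]
    have hv : h.expansion.IsSubtree {h.highest (S.out v)} (h.lowEdge (S.out v)) :=
      Tree.isSubtree_singleton h.contract (h.reflTransGen_lowest _ _ _) rfl
    exact hv.trans_singleton (Tree.isSubtree_inputs (T := h.expansion) (.inl v))

instance : IsSplitEpi h.contract :=
  ⟨⟨⟨h.expansionSection, Tree.hom_ext fun _ => rfl⟩⟩⟩

end HeightFunction

namespace Tree

/-! ### Degeneracies are determined by the heights of the edges in their fibres -/

variable {R R' S : Tree}

theorem ne_out_of_mem_inputs {v : S.Vert} {a : S.Edge} (h : a ∈ S.inputs v) : a ≠ S.out v :=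
  fun e => not_transGen_self (S.out v) (.single (parent_of_mem_inputs (e ▸ h)))

theorem edgeMap_surjective (σ : R ⟶ S) [IsSplitEpi σ] : Function.Surjective (edgeMap σ) :=
  fun e => ⟨edgeMap (section_ σ) e, congrArg (fun f => edgeMap f e) (IsSplitEpi.id σ)⟩

/-- In a subtree without leaves every edge is the output of a vertex. -/
theorem IsSubtree.exists_out_eq {L : Set S.Edge} {e x : S.Edge} (h : S.IsSubtree L e)
    (hL : L = ∅) (hx : S.Above x e) : ∃ v, S.out v = x := by
  induction h with
  | edge e => exact (Set.singleton_ne_empty e hL).elim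
  | vertex v L h ih =>
    by_cases e : x = S.out v
    · exact ⟨v, e.symm⟩
    · obtain ⟨a, ha, hxa⟩ := exists_input_of_above hx e
      exact ih ⟨a, ha⟩ (Set.iUnion_eq_empty.1 hL _) hxa

/-- A morphism that is surjective on edges maps a nondegenerate vertex to a single vertex, since
the image of the vertex has no inner edges. -/
theorem IsNondegenerate.exists_vertex {σ : R ⟶ S} (hσ : Function.Surjective (edgeMap σ))
    {v : R.Vert} (hv : IsNondegenerate σ v) :
    ∃ w, S.out w = edgeMap σ (R.out v) ∧ edgeMap σ '' R.inputs v = S.inputs w := by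
  obtain ⟨w, hw, h⟩ := ((isSubtree_inputs v).image σ).2.exists_vertex
    (fun ⟨a, ha, e⟩ => hv a ha e)
  refine ⟨w, hw, h fun a ha => ?_⟩
  obtain ⟨y, rfl⟩ := hσ a
  have hne : edgeMap σ y ≠ edgeMap σ (R.out v) := hw ▸ ne_out_of_mem_inputs ha
  have hy : S.Above (edgeMap σ y) (edgeMap σ (R.out v)) :=
    .single (hw ▸ parent_of_mem_inputs ha)
  obtain ⟨b, hb, hyb⟩ := exists_input_of_above (above_of_above_of_ne σ hy hne)
    (fun e => hne (congrArg _ e))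
  exact ⟨_, ⟨b, hb, rfl⟩, hyb.map σ⟩

/-- Every vertex of the target of a degeneracy is the image of a vertex whose output is the
highest edge of a fibre. For a vertex without inputs this uses the section: the fibre over the
output of such a vertex could otherwise consist of leaves. -/
theorem exists_isNondegenerate (σ : R ⟶ S) [IsSplitEpi σ] {w : S.Vert} {x : R.Edge}
    (hx : edgeMap σ x = S.out w) (htop : ∀ y, edgeMap σ y = edgeMap σ x → R.Above x y) :
    ∃ v, R.out v = x ∧ IsNondegenerate σ v := by
  have ex : ∃ v, R.out v = x := by
    rcases (S.inputs w).eq_empty_or_nonempty with he | ⟨a, ha⟩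
    · have h := ((isSubtree_inputs w).image (section_ σ)).2
      refine h.exists_out_eq (by rw [he, Set.image_empty]) (htop _ ?_)
      exact (congrArg (fun f => edgeMap f (S.out w)) (IsSplitEpi.id σ)).trans hx.symm
    · obtain ⟨y, rfl⟩ := edgeMap_surjective σ a
      have hne : edgeMap σ y ≠ edgeMap σ x := hx ▸ ne_out_of_mem_inputs ha
      have hy := above_of_above_of_ne σ (.single (hx ▸ parent_of_mem_inputs ha)) hne
      rcases Relation.ReflTransGen.cases_tail hy with e | ⟨_, _, v, _, hv⟩
      · exact (hne (congrArg _ e.symm)).elim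
      · exact ⟨v, hv⟩
  obtain ⟨v, rfl⟩ := ex
  exact ⟨v, rfl, fun a ha e => ne_out_of_mem_inputs ha
    (Above.antisymm (.single (parent_of_mem_inputs ha)) (htop a e))⟩

variable {X : Type} [PartialOrder X]

theorem le_of_above {h : R.Edge → X} (mono : ∀ x y, R.Parent x y → h y ≤ h x) {x y : R.Edge}
    (hxy : R.Above x y) : h y ≤ h x := by
  induction hxy with
  | refl => exact le_rfl
  | tail _ hyz ih => exact (mono _ _ hyz).trans ih

/-- In a fibre on which the heights are injective, the heights determine the order. -/
theorem above_of_le (σ : R ⟶ S) {h : R.Edge → X} (mono : ∀ x y, R.Parent x y → h y ≤ h x)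
    (inj : ∀ x y, edgeMap σ x = edgeMap σ y → h x = h y → x = y) {x y : R.Edge}
    (e : edgeMap σ x = edgeMap σ y) (hyx : h y ≤ h x) : R.Above x y := by
  rcases above_or_above (x := x) (y := y) σ (e ▸ .refl) with h' | h'
  · exact h'
  · rw [inj x y e (le_antisymm (le_of_above mono h') hyx)]

/-- A bijection between the edges over `S` that preserves heights is a morphism of trees: it
respects the linear fibres, and the nondegenerate vertices, which lie over the vertices of `S`. -/
theorem exists_hom_over (σ : R ⟶ S) (σ' : R' ⟶ S) [IsSplitEpi σ] [IsSplitEpi σ']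
    {h : R.Edge → X} {h' : R'.Edge → X}
    (mono : ∀ x y, R.Parent x y → h y ≤ h x) (mono' : ∀ x y, R'.Parent x y → h' y ≤ h' x)
    (inj' : ∀ x y, edgeMap σ' x = edgeMap σ' y → h' x = h' y → x = y)
    (ex : ∀ x, ∃ y, edgeMap σ' y = edgeMap σ x ∧ h' y = h x)
    (ex' : ∀ y, ∃ x, edgeMap σ' y = edgeMap σ x ∧ h' y = h x) :
    ∃ φ : R ⟶ R', ∀ x, edgeMap σ' (edgeMap φ x) = edgeMap σ x ∧ h' (edgeMap φ x) = h x := by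
  choose θ hθ hh using ex
  have surj : ∀ y, ∃ x, θ x = y := by
    intro y
    obtain ⟨x, hx, hx'⟩ := ex' y
    exact ⟨x, inj' _ _ ((hθ x).trans hx.symm) ((hh x).trans hx'.symm)⟩
  have above : ∀ {x y}, edgeMap σ x = edgeMap σ y → R.Above x y → R'.Above (θ x) (θ y) := by
    intro x y e hxy
    refine above_of_le σ' mono' inj' (by rw [hθ, hθ, e]) ?_
    rw [hh, hh]
    exact le_of_above mono hxy
  refine ⟨homMk θ (fun v x hx y hy e => ?_) (fun v => ?_), fun x => ⟨hθ x, hh x⟩⟩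
  · exact ((isSubtree_inputs v).image σ).1 hx hy (by rw [← hθ, ← hθ, e])
  by_cases hv : IsNondegenerate σ v
  · obtain ⟨w, hw, hin⟩ := hv.exists_vertex (edgeMap_surjective σ)
    -- The output of `v` is the highest edge of its fibre, hence so is its image under `θ`.
    obtain ⟨v', hv', hnd⟩ := exists_isNondegenerate σ' (w := w) (x := θ (R.out v))
      (by rw [hθ, hw]) (by
        intro y hy
        obtain ⟨x, rfl⟩ := surj y
        rw [hθ, hθ] at hy
        exact above hy.symm (hv.above hy))
    obtain ⟨w', hw', hin'⟩ := hnd.exists_vertex (edgeMap_surjective σ')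
    obtain rfl : w' = w := S.out_injective (by rw [hw', hv', hθ, hw])
    -- Inputs of nondegenerate vertices are the lowest edges of their fibres.
    have key : ∀ a ∈ R.inputs v, ∀ b ∈ R'.inputs v', edgeMap σ' b = edgeMap σ a → θ a = b := by
      intro a ha b hb e
      refine Above.antisymm ((hnd.isBottom hb).above (by rw [e, hθ])) ?_
      obtain ⟨x, rfl⟩ := surj b
      rw [hθ] at e
      exact above e ((hv.isBottom ha).above e.symm)
    have e : θ '' R.inputs v = R'.inputs v' := by
      ext b
      constructor
      · rintro ⟨a, ha, rfl⟩
        have : edgeMap σ a ∈ edgeMap σ' '' R'.inputs v' := by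
          rw [hin', ← hin]
          exact ⟨a, ha, rfl⟩
        obtain ⟨b, hb, e⟩ := this
        rw [key a ha b hb e]
        exact hb
      · intro hb
        have : edgeMap σ' b ∈ edgeMap σ '' R.inputs v := by
          rw [hin, ← hin']
          exact ⟨b, hb, rfl⟩
        obtain ⟨a, ha, e⟩ := this
        exact ⟨a, ha, key a ha b hb e.symm⟩
    rw [e, ← hv']
    exact isSubtree_inputs v'
  · simp only [IsNondegenerate, not_forall, not_not] at hv
    obtain ⟨a, ha, e⟩ := hv
    rw [inputs_eq_singleton σ ha e, Set.image_singleton]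
    exact isSubtree_singleton σ' (above e (.single (parent_of_mem_inputs ha))) (by rw [hθ, hθ, e])

/-- A degeneracy with an order preserving height on its source, injective on each fibre, is
determined up to isomorphism by the sets of heights that occur in the fibres. -/
theorem exists_iso_over (σ : R ⟶ S) (σ' : R' ⟶ S) [IsSplitEpi σ] [IsSplitEpi σ']
    {h : R.Edge → X} {h' : R'.Edge → X}
    (mono : ∀ x y, R.Parent x y → h y ≤ h x) (mono' : ∀ x y, R'.Parent x y → h' y ≤ h' x)
    (inj : ∀ x y, edgeMap σ x = edgeMap σ y → h x = h y → x = y)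
    (inj' : ∀ x y, edgeMap σ' x = edgeMap σ' y → h' x = h' y → x = y)
    (ex : ∀ x, ∃ y, edgeMap σ' y = edgeMap σ x ∧ h' y = h x)
    (ex' : ∀ y, ∃ x, edgeMap σ x = edgeMap σ' y ∧ h x = h' y) :
    ∃ φ : R ≅ R', ∀ x,
      edgeMap σ' (edgeMap φ.hom x) = edgeMap σ x ∧ h' (edgeMap φ.hom x) = h x := by
  obtain ⟨φ, hφ⟩ := exists_hom_over σ σ' mono mono' inj' ex
    (fun y => (ex' y).imp fun _ h => ⟨h.1.symm, h.2.symm⟩)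
  obtain ⟨ψ, hψ⟩ := exists_hom_over σ' σ mono' mono inj ex'
    (fun y => (ex y).imp fun _ h => ⟨h.1.symm, h.2.symm⟩)
  refine ⟨⟨φ, ψ, hom_ext fun x => ?_, hom_ext fun x => ?_⟩, hφ⟩
  · exact inj _ _ ((hψ _).1.trans (hφ _).1) ((hψ _).2.trans (hφ _).2)
  · exact inj' _ _ ((hφ _).1.trans (hψ _).1) ((hφ _).2.trans (hψ _).2)

end Tree

open Opposite Limits

/-! ### Dendrices of `Δ[n] ⊗ Ω[T]` -/

section Dendrices

variable {X : Type} [PartialOrder X] {R T : Tree}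

/-- The height of an edge of a dendrex of the tensor product. -/
def height (g : Operad.Hom R.operad (Operad.bv (Operad.ofPreorder X) T.operad)) (x : R.Edge) : X :=
  (g.color x).1

theorem height_le_of_parent (g : Operad.Hom R.operad (Operad.bv (Operad.ofPreorder X) T.operad))
    (x y : R.Edge) (h : R.Parent x y) : height g y ≤ height g x := by
  obtain ⟨v, hv, rfl⟩ := h
  have p : R.operad.Op (I := R.inputs v) (fun x => x.1) (R.out v) :=
    ⟨Subtype.val_injective, by rw [Subtype.range_coe]; exact Tree.isSubtree_inputs v⟩
  exact ((Operad.nonempty_bv_op _ _).1 ⟨g.op p⟩).2 ⟨x, hv⟩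

/-- The morphism of trees underlying a dendrex of the tensor product. -/
noncomputable def baseHom
    (g : Operad.Hom R.operad (Operad.bv (Operad.ofPreorder X) T.operad)) : R ⟶ T :=
  Operad.Hom.ofIsThin (P := R.operad) T.isThin_operad (fun x => (g.color x).2)
    fun p => ((Operad.nonempty_bv_op _ _).1 ⟨g.op p⟩).1

/-- A morphism of trees and an order preserving height function, which assigns a single height to
each edge, determine a dendrex of the tensor product. -/
noncomputable def dendrex (u : R ⟶ T) (h : R.Edge → X)
    (mono : ∀ x y, R.Parent x y → h y ≤ h x) :
    Operad.Hom R.operad (Operad.bv (Operad.ofPreorder X) T.operad) :=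
  Operad.Hom.ofIsThin (Operad.isThin_bv T.isThin_operad) (fun x => (h x, Tree.edgeMap u x))
    fun {I} _ {c d} p => (Operad.nonempty_bv_op _ _).2 ⟨⟨Operad.Hom.op u p⟩, fun i => by
      exact Tree.le_of_above mono (p.down.2.le ⟨i, rfl⟩)⟩

theorem dendrex_ext {g g' : Operad.Hom R.operad (Operad.bv (Operad.ofPreorder X) T.operad)}
    (h : ∀ x, g.color x = g'.color x) : g = g' :=
  Operad.Hom.ext_of_isThin (Operad.isThin_bv T.isThin_operad) (funext h)

end Dendrices

variable {n : ℕ} {R T : Tree}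

/-- The operad morphisms that are the dendrices of shape `R` of `Δ[n] ⊗ Ω[T]`. -/
abbrev Dendrex (n : ℕ) (R T : Tree) : Type 1 :=
  Operad.Hom R.operad (Operad.bv (linearOperad (SimplexCategory.mk n)) T.operad)

/-- The map of dendroidal sets given by a dendrex of `Δ[n] ⊗ Ω[T]`. -/
noncomputable def dendrexMap (g : Dendrex n R T) : representable R ⟶ stdTensor n T :=
  yonedaEquiv.symm (show (nerve _).obj (op R) from g) ≫ stdTensorUnit n T

theorem exists_dendrexMap_eq (f : representable R ⟶ stdTensor n T) :
    ∃ g : Dendrex n R T, dendrexMap g = f := by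
  have := isIso_stdTensorUnit n T
  refine ⟨yonedaEquiv (f ≫ inv (stdTensorUnit n T)), ?_⟩
  exact (IsIso.eq_comp_inv (stdTensorUnit n T)).1 (yonedaEquiv.symm_apply_apply _)

theorem dendrexMap_injective : Function.Injective (dendrexMap : Dendrex n R T → _) := by
  intro g g' h
  have := isIso_stdTensorUnit n T
  exact yonedaEquiv.symm.injective ((cancel_mono (stdTensorUnit n T)).1 h)

theorem map_dendrexMap {R' : Tree} (φ : R' ⟶ R) (g : Dendrex n R T) :
    yoneda.map φ ≫ dendrexMap g =
      dendrexMap (Operad.Hom.comp (P := R'.operad) (Q := R.operad) φ g) := by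
  unfold dendrexMap
  rw [← Category.assoc, yonedaEquiv_symm_naturality_left]
  rfl

theorem dendrexMap_stdTensorMap {F : Tree} (g : Dendrex n R F) (v : F ⟶ T) :
    dendrexMap g ≫ stdTensorMap n v =
      dendrexMap (g.comp (Operad.bvMap (Operad.Hom.id _) v)) := by
  have nat := congrArg (fun α => α.app (SimplexCategory.mk n))
    ((SSet.stdSimplex.{0}.lanUnit (H := DSet)).naturality (simplexTensor.map v))
  have nat' : nerveMap (Operad.bvMap (Operad.Hom.id (linearOperad (SimplexCategory.mk n))) v) ≫
      stdTensorUnit n T = stdTensorUnit n F ≫ stdTensorMap n v := nat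
  unfold dendrexMap
  rw [Category.assoc, ← nat', ← Category.assoc, yonedaEquiv_symm_naturality_right]
  rfl

theorem stdTensorUnit_naturality {k : ℕ} (α : SimplexCategory.mk k ⟶ SimplexCategory.mk n) :
    nerveMap (Operad.bvMap (Operad.ofPreorderMap α.toOrderHom) (Operad.Hom.id T.operad)) ≫
      stdTensorUnit n T = stdTensorUnit k T ≫ (tensor.obj T).map (SSet.stdSimplex.map α) :=
  ((SSet.stdSimplex.{0}.lanUnit (H := DSet)).app (simplexTensor.obj T)).naturality α

theorem dendrexMap_map {k : ℕ} (g : Dendrex k R T)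
    (α : SimplexCategory.mk k ⟶ SimplexCategory.mk n) :
    dendrexMap g ≫ (tensor.obj T).map (SSet.stdSimplex.map α) =
      dendrexMap (g.comp (Operad.bvMap (Operad.ofPreorderMap α.toOrderHom)
        (Operad.Hom.id T.operad))) := by
  unfold dendrexMap
  rw [Category.assoc, ← stdTensorUnit_naturality, ← Category.assoc,
    yonedaEquiv_symm_naturality_right]
  rfl

/-- A dendrex of `Δ[n] ⊗ Ω[T]` is a monomorphism if and only if it is injective on edges, since
it is determined by its values on edges. -/
theorem mono_dendrexMap_iff (g : Dendrex n R T) :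
    Mono (dendrexMap g) ↔ Function.Injective g.color := by
  constructor
  · intro _ x y h
    have : yoneda.map (Tree.ofEdge x) ≫ dendrexMap g =
        yoneda.map (Tree.ofEdge y) ≫ dendrexMap g := by
      rw [map_dendrexMap, map_dendrexMap]
      exact congrArg _ (dendrex_ext fun _ => h)
    have := yoneda.map_injective ((cancel_mono _).1 this)
    exact congrArg (fun f => Tree.edgeMap f ()) this
  · intro h
    have := isIso_stdTensorUnit n T
    let N := nerve (Operad.bv (linearOperad (SimplexCategory.mk n)) T.operad)
    have : Mono (yonedaEquiv.symm (show N.obj (op R) from g)) := by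
      have (U : Treeᵒᵖ) : Mono ((yonedaEquiv.symm (show N.obj (op R) from g)).app U) := by
        rw [CategoryTheory.mono_iff_injective]
        intro f f' e
        refine Tree.hom_ext fun x => h ?_
        exact congrFun (congrArg Operad.Hom.color e) x
      exact NatTrans.mono_of_mono_app _
    exact mono_comp _ _

/-! ### Factorizations through faces -/

/-- The values of a pointwise left Kan extension are colimits, and colimits of presheaves are
computed pointwise, so every element of such a value comes from a term of the colimit. -/
theorem exists_of_leftKanExtension {C : Type} [SmallCategory C] {D : Type 1} [Category.{0} D]
    {K : Type 1} [Category.{1} K] (L : C ⥤ D) (F : C ⥤ K ⥤ Type 1)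
    [L.HasPointwiseLeftKanExtension F] (X : D) (U : K)
    (y : ((L.leftKanExtension F).obj X).obj U) :
    ∃ (c : C) (α : L.obj c ⟶ X) (z : (F.obj c).obj U),
      ((L.leftKanExtension F).map α).app U (((L.leftKanExtensionUnit F).app c).app U z) = y := by
  have hc := isColimitOfPreserves ((evaluation K (Type 1)).obj U)
    (Functor.isPointwiseLeftKanExtensionOfIsLeftKanExtension _ (L.leftKanExtensionUnit F) X)
  obtain ⟨j, z, hz⟩ := Types.jointly_surjective_of_isColimit hc y
  exact ⟨j.left, j.hom, z, hz⟩

/-- Every dendrex of `X ⊗ Ω[T]` comes from a simplex of `X`. -/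
theorem exists_simplex_of_dendrex (X : SSet.{0}) (f : representable R ⟶ (tensor.obj T).obj X) :
    ∃ (k : ℕ) (α : SSet.stdSimplex.obj (SimplexCategory.mk k) ⟶ X) (g : Dendrex k R T),
      f = dendrexMap g ≫ (tensor.obj T).map α := by
  obtain ⟨j, α, y, hy⟩ := exists_of_leftKanExtension SSet.stdSimplex.{0} (simplexTensor.obj T) X
    (op R) (yonedaEquiv f)
  refine ⟨j.len, α, y, yonedaEquiv.injective (hy.symm.trans ?_)⟩
  unfold dendrexMap
  rw [Category.assoc, yonedaEquiv_symm_naturality_right]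
  exact (yonedaEquiv.apply_symm_apply _).symm

/-- A set `J` of vertices is an order preserving retract, as far as the vertices `i ≥ r` are
concerned: `i` is mapped to the greatest element of `J` below `max i r`, which exists since `r` is
in `J`. -/
theorem exists_retraction {J : Set (Fin (n + 1))} {r : Fin (n + 1)} (hr : r ∈ J) :
    ∃ α : Fin (n + 1) →o Fin (n + 1), (∀ i, α i ∈ J) ∧ ∀ i ∈ J, r ≤ i → α i = i := by
  have ex : ∀ i, ∃ j, IsGreatest {j | j ∈ J ∧ j ≤ max i r} j := by
    intro i
    obtain ⟨j, hj, h⟩ := Set.exists_max_image {j | j ∈ J ∧ j ≤ max i r} id (Set.toFinite _)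
      ⟨r, hr, le_max_right _ _⟩
    exact ⟨j, hj, h⟩
  choose α hα using ex
  refine ⟨⟨α, fun i i' h => (hα i').2 ⟨(hα i).1.1, (hα i).1.2.trans (max_le_max_right r h)⟩⟩,
    fun i => (hα i).1.1, fun i hi hri => ?_⟩
  refine le_antisymm ?_ ((hα i).2 ⟨hi, le_max_left _ _⟩)
  have := (hα i).1.2
  rwa [max_eq_left hri] at this

theorem mem_iInf_oppFace {I : Set (Fin (n + 1))} {d : ℕ}
    (x : (SSet.stdSimplex.{0}.obj (SimplexCategory.mk n)).obj (op (SimplexCategory.mk d))) :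
    x ∈ (⨅ i ∈ I, oppFace n i : SSet.Subcomplex _).obj (op (SimplexCategory.mk d)) ↔
      ∀ j : Fin (d + 1), (x : Fin (d + 1) → Fin (n + 1)) j ∉ I := by
  simp only [oppFace, Subfunctor.iInf_obj, Set.mem_iInter, SSet.stdSimplex.mem_face_iff,
    Finset.mem_compl, Finset.mem_singleton]
  exact ⟨fun h j hj => h _ hj j rfl, fun h i hi j e => h j (e ▸ hi)⟩

/-- A dendrex lies over an intersection of faces of `Δ[n]` if and only if all of its heights avoid
the opposite vertices. For the construction of a factorization the heights that are to be avoided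
are retracted to other ones. -/
theorem factorsThrough_subTensorMap_iff (g : Dendrex n R T) (I : Set (Fin (n + 1))) :
    FactorsThrough (dendrexMap g) (subTensorMap n T (⨅ i ∈ I, oppFace n i)) ↔
      ∀ x, height g x ∉ I := by
  constructor
  · rintro ⟨f, hf⟩ x
    obtain ⟨k, α, g', rfl⟩ := exists_simplex_of_dendrex _ f
    obtain ⟨β, hβ⟩ := SSet.stdSimplex.{0}.map_surjective
      (α ≫ (⨅ i ∈ I, oppFace n i : SSet.Subcomplex _).ι)
    unfold subTensorMap at hf
    rw [Category.assoc, ← Functor.map_comp, ← hβ, dendrexMap_map] at hf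
    rw [← dendrexMap_injective hf]
    have h := (SSet.yonedaEquiv α).2
    have h' : SSet.stdSimplex.objEquiv.symm β = (SSet.yonedaEquiv α).1 := by
      rw [← SSet.yonedaEquiv_map, hβ]
      rfl
    rw [← h', mem_iInf_oppFace] at h
    exact h (height g' x)
  · intro h
    obtain ⟨α, hα, hα'⟩ := exists_retraction (J := Iᶜ) (h R.root)
    let β : SimplexCategory.mk n ⟶ SimplexCategory.mk n := SimplexCategory.Hom.mk α
    have hβ : SSet.stdSimplex.objEquiv.symm β ∈ (⨅ i ∈ I, oppFace n i : SSet.Subcomplex _).obj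
        (op (SimplexCategory.mk n)) := (mem_iInf_oppFace _).2 hα
    let γ : SSet.stdSimplex.obj (SimplexCategory.mk n) ⟶
        (⨅ i ∈ I, oppFace n i : SSet.Subcomplex _).toSSet := SSet.yonedaEquiv.symm ⟨_, hβ⟩
    -- The height of the root is the smallest one, so the retraction fixes all heights of `g`.
    refine ⟨dendrexMap g ≫ (tensor.obj T).map γ, ?_⟩
    have e : γ ≫ (⨅ i ∈ I, oppFace n i : SSet.Subcomplex _).ι =
        SSet.stdSimplex.map β := rfl
    unfold subTensorMap
    rw [Category.assoc, ← Functor.map_comp, e, dendrexMap_map]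
    exact congrArg dendrexMap (dendrex_ext fun x => Prod.ext (hα' _ (h x)
      (Tree.le_of_above (height_le_of_parent g) (R.to_root x))) rfl)

theorem factorsThrough_stdTensorMap_iff {F : Tree} (g : Dendrex n R T) (v : F ⟶ T) :
    FactorsThrough (dendrexMap g) (stdTensorMap n v) ↔ FactorsThrough (baseHom g) v := by
  constructor
  · rintro ⟨f, hf⟩
    obtain ⟨g', rfl⟩ := exists_dendrexMap_eq f
    rw [dendrexMap_stdTensorMap] at hf
    rw [← dendrexMap_injective hf]
    exact ⟨baseHom g', Tree.hom_ext fun _ => rfl⟩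
  · rintro ⟨u, hu⟩
    refine ⟨dendrexMap (dendrex u (height g) (height_le_of_parent g)), ?_⟩
    rw [dendrexMap_stdTensorMap]
    refine congrArg dendrexMap (dendrex_ext fun x => Prod.ext rfl ?_)
    exact congrArg (fun f => Tree.edgeMap f x) hu

/-! ### The correspondence of monomorphisms and faces with heights -/

theorem TreeMono.exists_corresponds (m : TreeMono n T) : ∃ p : HeightFace n T, Corresponds m p := by
  obtain ⟨g, hg⟩ := exists_dendrexMap_eq m.hom
  let σ := Tree.toImage (baseHom g)
  let h : HeightFunction n (Tree.image (baseHom g)) :=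
    { val := fun e => {i | ∃ x, Tree.edgeMap σ x = e ∧ height g x = i}
      nonempty := fun e => by
        obtain ⟨x, hx⟩ := Tree.edgeMap_surjective σ e
        exact ⟨_, x, hx, rfl⟩
      monotone := by
        rintro _ _ h _ ⟨x, rfl, rfl⟩ _ ⟨x', rfl, rfl⟩
        have hne : Tree.edgeMap σ x' ≠ Tree.edgeMap σ x := fun e =>
          Tree.not_transGen_self (Tree.edgeMap σ x) (by rw [e] at h; exact h)
        exact Tree.le_of_above (height_le_of_parent g)
          (Tree.above_of_above_of_ne σ h.to_reflTransGen hne) }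
  refine ⟨⟨_, Tree.imageSection (baseHom g) ≫ baseHom g, inferInstance, h⟩, g, σ, hg,
    inferInstanceAs (IsSplitEpi (Tree.toImage _)), fun x => ?_, fun _ => rfl⟩
  exact (congrArg (fun f => Tree.edgeMap f x) (Tree.toImage_fac (baseHom g))).symm

theorem HeightFace.exists_corresponds (p : HeightFace n T) :
    ∃ m : TreeMono n T, Corresponds m p := by
  let h := p.height
  let g : Dendrex n h.expansion T :=
    dendrex (h.contract ≫ p.face) h.level fun _ _ => h.level_le_of_parent
  have hg : Mono (dendrexMap g) := by
    have := p.mono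
    refine (mono_dendrexMap_iff g).2 fun x y e => h.edge_ext ?_ (congrArg Prod.fst e)
    exact Tree.edgeMap_injective p.face (congrArg Prod.snd e)
  refine ⟨⟨h.expansion, dendrexMap g, hg⟩, g, h.contract, rfl,
    inferInstanceAs (IsSplitEpi h.contract), fun _ => rfl, fun e => ?_⟩
  ext i
  constructor
  · exact fun hi => ⟨(⟨(e, i), hi⟩ : h.Level), rfl, rfl⟩
  · rintro ⟨x, rfl, rfl⟩
    exact h.level_mem x

theorem Corresponds.congr_right {m : TreeMono n T} {p p' : HeightFace n T}
    (h : Corresponds m p) (e : p ≈ p') : Corresponds m p' := by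
  obtain ⟨g, σ, hg, hσ, hbase, hval⟩ := h
  obtain ⟨φ, hφ, hφ'⟩ := e
  have inv (e) : Tree.edgeMap φ.hom (Tree.edgeMap φ.inv e) = e :=
    congrArg (fun f => Tree.edgeMap f e) φ.inv_hom_id
  have inv' (e) : Tree.edgeMap φ.inv (Tree.edgeMap φ.hom e) = e :=
    congrArg (fun f => Tree.edgeMap f e) φ.hom_inv_id
  refine ⟨g, σ ≫ φ.hom, hg, ⟨⟨⟨φ.inv ≫ section_ σ, by simp⟩⟩⟩, fun x => ?_, fun e => ?_⟩
  · rw [hbase, ← hφ]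
    rfl
  · rw [← inv e, hφ', hval]
    ext i
    refine exists_congr fun x => and_congr_left fun _ => ?_
    rw [inv]
    exact ⟨fun h => (congrArg (Tree.edgeMap φ.hom) h).trans (inv e),
      fun h => (inv' _).symm.trans (congrArg (Tree.edgeMap φ.inv) h)⟩

theorem Corresponds.congr_left {m m' : TreeMono n T} {p : HeightFace n T}
    (h : Corresponds m p) (e : m ≈ m') : Corresponds m' p := by
  obtain ⟨g, σ, hg, hσ, hbase, hval⟩ := h
  obtain ⟨φ, hφ⟩ := Setoid.symm e
  refine ⟨Operad.Hom.comp (P := m'.tree.operad) (Q := m.tree.operad) φ.hom g, φ.hom ≫ σ, ?_,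
    ⟨⟨⟨section_ σ ≫ φ.inv, by simp⟩⟩⟩, fun x => hbase _, fun e => ?_⟩
  · rw [← hφ, ← hg]
    exact (map_dendrexMap φ.hom g).symm
  · rw [hval]
    ext i
    constructor
    · rintro ⟨x, hx, hi⟩
      have hinv : Tree.edgeMap φ.hom (Tree.edgeMap φ.inv x) = x :=
        congrArg (fun f => Tree.edgeMap f x) φ.inv_hom_id
      refine ⟨Tree.edgeMap φ.inv x, ?_, ?_⟩
      · rw [Tree.edgeMap_comp, hinv, hx]
      · exact (congrArg (fun y => (g.color y).1) hinv).trans hi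
    · rintro ⟨x, hx, hi⟩
      exact ⟨Tree.edgeMap φ.hom x, hx, hi⟩

/-- The factorization of a morphism of trees into a degeneracy and a face is unique, and the
degeneracy determines the height function. -/
theorem Corresponds.unique_right {m : TreeMono n T} {p p' : HeightFace n T}
    (h : Corresponds m p) (h' : Corresponds m p') : p ≈ p' := by
  obtain ⟨g, σ, hg, hσ, hbase, hval⟩ := h
  obtain ⟨g', σ', hg', hσ', hbase', hval'⟩ := h'
  obtain rfl : g = g' := dendrexMap_injective (hg.trans hg'.symm)
  have := p.mono
  have := p'.mono
  have e : σ ≫ p.face = σ' ≫ p'.face :=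
    Tree.hom_ext fun x => (hbase x).symm.trans (hbase' x)
  have e₁ : (section_ σ ≫ σ') ≫ p'.face = p.face := by
    rw [Category.assoc, ← e, IsSplitEpi.id_assoc]
  have e₂ : (section_ σ' ≫ σ) ≫ p.face = p'.face := by
    rw [Category.assoc, e, IsSplitEpi.id_assoc]
  have e₃ : σ ≫ section_ σ ≫ σ' = σ' := by
    rw [← cancel_mono p'.face, Category.assoc, e₁, e]
  -- The isomorphism compares the faces by means of sections of the degeneracies.
  refine ⟨⟨section_ σ ≫ σ', section_ σ' ≫ σ, ?_, ?_⟩, e₁, fun x => ?_⟩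
  · rw [← cancel_mono p.face, Category.assoc, e₂, e₁, Category.id_comp]
  · rw [← cancel_mono p'.face, Category.assoc, e₁, e₂, Category.id_comp]
  · rw [hval, hval']
    ext i
    refine exists_congr fun y => and_congr_left fun _ => ?_
    have hy : Tree.edgeMap (section_ σ ≫ σ') (Tree.edgeMap σ y) = Tree.edgeMap σ' y :=
      congrArg (fun f => Tree.edgeMap f y) e₃
    have := mono_of_mono_fac e₁
    rw [← hy]
    exact (Tree.edgeMap_injective (section_ σ ≫ σ')).eq_iff

theorem Corresponds.unique_left {m m' : TreeMono n T} {p : HeightFace n T}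
    (h : Corresponds m p) (h' : Corresponds m' p) : m ≈ m' := by
  obtain ⟨g, σ, hg, hσ, hbase, hval⟩ := h
  obtain ⟨g', σ', hg', hσ', hbase', hval'⟩ := h'
  change dendrexMap g = m.hom at hg
  change dendrexMap g' = m'.hom at hg'
  have inj := (mono_dendrexMap_iff g).1 (hg ▸ m.mono)
  have inj' := (mono_dendrexMap_iff g').1 (hg' ▸ m'.mono)
  have val (e i) : (∃ x, Tree.edgeMap σ x = e ∧ height g x = i) ↔
      ∃ x, Tree.edgeMap σ' x = e ∧ height g' x = i :=
    Set.ext_iff.1 ((hval e).symm.trans (hval' e)) i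
  obtain ⟨φ, hφ⟩ := Tree.exists_iso_over σ σ' (height_le_of_parent g) (height_le_of_parent g')
    (fun x y e e' => inj (Prod.ext e' (by rw [hbase, hbase, e])))
    (fun x y e e' => inj' (Prod.ext e' (by rw [hbase', hbase', e])))
    (fun x => (val _ _).1 ⟨x, rfl, rfl⟩) (fun x => (val _ _).2 ⟨x, rfl, rfl⟩)
  refine ⟨φ, ?_⟩
  rw [← hg, ← hg', map_dendrexMap]
  refine congrArg _ (dendrex_ext fun x => Prod.ext (hφ x).2 ?_)
  exact (hbase' _).trans ((congrArg _ (hφ x).1).trans (hbase x).symm)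

end Dendroidal

theorem lemma1 (n : ℕ) (T : Dendroidal.Tree) :
    ∃ Φ : Quotient (Dendroidal.TreeMono.setoid n T) ≃ Quotient (Dendroidal.HeightFace.setoid n T),
      ∀ (m : Dendroidal.TreeMono n T) (p : Dendroidal.HeightFace n T),
        Φ (Quotient.mk _ m) = Quotient.mk _ p →
          Dendroidal.Corresponds m p ∧
          (∀ i : Fin (n + 1),
            Dendroidal.FactorsThrough m.hom
                (Dendroidal.subTensorMap n T (Dendroidal.oppFace n i)) ↔
              ∀ e, i ∉ p.height.val e) ∧
          (∀ I : Set (Fin (n + 1)),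
            Dendroidal.FactorsThrough m.hom
                (Dendroidal.subTensorMap n T (⨅ i ∈ I, Dendroidal.oppFace n i)) ↔
              ∀ e, ∀ i ∈ I, i ∉ p.height.val e) ∧
          (∀ (F : Dendroidal.Tree) (v : F ⟶ T), Mono v →
            (Dendroidal.FactorsThrough m.hom (Dendroidal.stdTensorMap n v) ↔
              Dendroidal.FactorsThrough p.face v)) := by
  choose P hP using fun m : Dendroidal.TreeMono n T => m.exists_corresponds
  let Φ : Quotient (Dendroidal.TreeMono.setoid n T) → Quotient (Dendroidal.HeightFace.setoid n T) :=
    Quotient.map P fun m m' e => ((hP m).congr_left e).unique_right (hP m')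
  have hΦ : Function.Bijective Φ := by
    constructor
    · intro a b e
      induction a using Quotient.inductionOn with | h m =>
      induction b using Quotient.inductionOn with | h m' =>
      exact Quotient.sound (((hP m).congr_right (Quotient.exact e)).unique_left (hP m'))
    · intro b
      induction b using Quotient.inductionOn with | h p =>
      obtain ⟨m, hm⟩ := p.exists_corresponds
      exact ⟨Quotient.mk _ m, Quotient.sound ((hP m).unique_right hm)⟩
  refine ⟨Equiv.ofBijective Φ hΦ, fun m p e => ?_⟩
  have h : Dendroidal.Corresponds m p := (hP m).congr_right (Quotient.exact e)
  refine ⟨h, ?_⟩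
  obtain ⟨g, σ, hg, hσ, hbase, hval⟩ := h
  have faces (I : Set (Fin (n + 1))) : Dendroidal.FactorsThrough m.hom
      (Dendroidal.subTensorMap n T (⨅ i ∈ I, Dendroidal.oppFace n i)) ↔
        ∀ e, ∀ i ∈ I, i ∉ p.height.val e := by
    rw [← hg]
    refine (Dendroidal.factorsThrough_subTensorMap_iff g I).trans
      ⟨fun h e i hi he => ?_, fun h x hx => ?_⟩
    · rw [hval] at he
      obtain ⟨x, -, rfl⟩ := he
      exact h x hi
    · refine h (Dendroidal.Tree.edgeMap σ x) _ hx ?_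
      rw [hval]
      exact ⟨x, rfl, rfl⟩
  refine ⟨fun i => ?_, faces, fun F v _ => ?_⟩
  · have := faces {i}
    rw [iInf_singleton] at this
    simpa using this
  · rw [← hg]
    refine (Dendroidal.factorsThrough_stdTensorMap_iff g v).trans ?_
    have hb : Dendroidal.baseHom g = σ ≫ p.face := Dendroidal.Tree.hom_ext hbase
    rw [hb]
    constructor
    · rintro ⟨u, hu⟩
      exact ⟨section_ σ ≫ u, by rw [Category.assoc, hu, IsSplitEpi.id_assoc]⟩
    · rintro ⟨u, hu⟩
      exact ⟨σ ≫ u, by rw [Category.assoc, hu]⟩
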